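/- **Setting.** Let $d\ge 1$, let $f:\mathbb{R}^d\to\mathbb{R}\cup\{\infty\}$ be proper, closed (lower semicontinuous) and $\ell$-weakly convex with $\ell>0$, i.e. $f+\frac{\ell}{2}\|\cdot\|^2$ is convex. Let $0<\lambda<\frac{1}{2\ell}$ and $$f_\lambda(x)=\min_y\Big\{f(y)+\tfrac1{2\lambda}\|y-x\|^2\Big\},\qquad \mathrm{prox}_{\lambda f}(x)=\operatorname*{argmin}_y\Big\{f(y)+\tfrac1{2\lambda}\|y-x\|^2\Big\}.$$ Assume $f_\lambda^\star:=\inf f_\lambda>-\infty$, let $x_0\in\mathbb{R}^d$ and $\Delta:=f_\lambda(x_0)-f_\lambda^\star$. Let $\rho>0$, $\epsilon\in(0,1/(\lambda^2\rho))$ and $\delta\in(0,1)$. For $\iota>0$ put $$\eta=\lambda,\quad r=\frac{\epsilon}{400\iota^3},\quad \mathscr{T}=\frac{\iota}{\lambda\sqrt{\rho\epsilon}},\quad \mathscr{F}=\frac{1}{50\iota^3}\sqrt{\frac{\epsilon^3}{\rho}},\quad \mathscr{S}=\frac1{4\iota}\sqrt{\frac{\epsilon}{\rho}},\quad T=4\max\Big\{\frac{\Delta}{\mathscr{F}/(2\mathscr{T})},\frac{\Delta}{\eta\epsilon^2/2}\Big\}.$$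 *Perturbed PPA:* start with $x_0$ and $t_{\rm perturb}=0$. In round $t=0,1,2,\dots$: if $\|\nabla f_\lambda(x_t)\|\le\epsilon$ and $t-t_{\rm perturb}>\mathscr{T}$, put $x_t^+=x_t-\eta\xi_t$ and $t_{\rm perturb}=t$; otherwise put $x_t^+=x_t$. Then set $x_{t+1}=\mathrm{prox}_{\eta f}(x_t^+)$. The $\xi_t$ are independent and uniformly distributed on the closed ball of radius $r$ around $0$. *Hessian assumption (with parameter $\iota$):* around the (approximate) critical points $f_\lambda$ has a $\rho$-Lipschitz Hessian; precisely, for every $x$ with $\|\nabla f_\lambda(x)\|\le\epsilon$, the function $f_\lambda$ is twice differentiable on the open ball $B(x,\mathscr{S})$ and $\|\nabla^2f_\lambda(y)-\nabla^2f_\lambda(z)\|\le\rho\|y-z\|$ for all $y,z\in B(x,\mathscr{S})$. **Theorem.** There is an absolute constant $c_0>0$ such that the following holds. 1. In the setting above, let $$\iota\ge c_0\max\Big\{1,\log\frac{d\,\Delta}{\lambda\epsilon^2\delta}\Big\}$$ (where the maximum is read as $1$ if $\Delta=0$), and let the Hessian assumption hold. Then $f_\lambda$ is differentiable and $\mathrm{prox}_{\lambda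 f}(x)=x-\lambda\nabla f_\lambda(x)$ for all $x$, so that perturbed PPA is perturbed gradient descent on $f_\lambda$ with step size $\lambda$; and with probability at least $1-\delta$, at least half of the indices $t\in\{0,\dots,\lceil T\rceil-1\}$ are such that $f_\lambda$ is twice differentiable and $$\|\nabla f_\lambda(x)\|\le\epsilon,\qquad \lambda_{\min}(\nabla^2f_\lambda(x))>-\sqrt{\rho\epsilon}$$ at both $x=x_t$ and $x=x_t^+$. At these points $\mathrm{prox}_{\lambda f}$ is moreover differentiable with $\lambda_{\max}(\nabla\,\mathrm{prox}_{\lambda f}(x))<1+\lambda\sqrt{\rho\epsilon}$, i.e. $x$ is an $\epsilon$-approximate local minimum. 2. For every $c\ge c_0$ there is a constant $K$, depending only on $c$, such that with $\iota=c\max\{1,\log\frac{d\Delta}{\lambda\epsilon^2\delta}\}$, for all $d\ge2$, all $\lambda,\rho,\epsilon,\delta>0$ and all $\Delta\ge0$, $$T\le K\,\frac{\Delta}{\lambda\epsilon^2}\,(\log d)^4\Big(1+\log^+\frac{\Delta}{\lambda\epsilon^2\delta}\Big)^4,\qquad \log^+u=\max\{0,\log u\}\ \ (\log^+0=0);$$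 that is, $T=O\big(\frac{f_\lambda(x_0)-f_\lambda^\star}{\lambda\epsilon^2}(\log d)^4\big)$ up to logarithmic factors in the other parameters. -/

import Mathlib

noncomputable section

namespace PerturbedProx

open MeasureTheory

/-- The Euclidean space `ℝ^d`. -/
abbrev Eu (d : ℕ) : Type := EuclideanSpace ℝ (Fin d)

/-- `f : ℝ^d → ℝ ∪ {∞}` is proper and closed (lower semicontinuous). -/
structure ClosedProper {d : ℕ} (f : Eu d → EReal) : Prop where
  ne_bot : ∀ x, f x ≠ ⊥
  proper : ∃ x, f x ≠ ⊤
  lsc : LowerSemicontinuous f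

/-- `f` is `ell`-weakly convex: `f + (ell / 2) ‖·‖²` is convex, i.e. has a convex epigraph. -/
def WeaklyConvex {d : ℕ} (f : Eu d → EReal) (ell : ℝ) : Prop :=
  Convex ℝ {p : Eu d × ℝ | f p.1 + ((ell / 2 * ‖p.1‖ ^ 2 : ℝ) : EReal) ≤ (p.2 : EReal)}

/-- The function `y ↦ f y + ‖y - x‖² / (2 lam)`. -/
def proxObjective {d : ℕ} (f : Eu d → EReal) (lam : ℝ) (x y : Eu d) : EReal :=
  f y + ((1 / (2 * lam) * ‖y - x‖ ^ 2 : ℝ) : EReal)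

/-- The Moreau envelope `f_lam`. -/
def moreau {d : ℕ} (f : Eu d → EReal) (lam : ℝ) (x : Eu d) : ℝ :=
  (⨅ y, proxObjective f lam x y).toReal

/-- The proximal map: a minimizer of `proxObjective f lam x` (unique in the setting of interest). -/
def prox {d : ℕ} (f : Eu d → EReal) (lam : ℝ) (x : Eu d) : Eu d :=
  Classical.epsilon fun p => ∀ y, proxObjective f lam x p ≤ proxObjective f lam x y

/-- The Hessian, as the derivative of the gradient. -/
def hessian {d : ℕ} (F : Eu d → ℝ) (x : Eu d) : Eu d →L[ℝ] Eu d :=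
  fderiv ℝ (gradient F) x

/-- `F` is twice differentiable at `x`. -/
def TwiceDifferentiableAt {d : ℕ} (F : Eu d → ℝ) (x : Eu d) : Prop :=
  (∀ᶠ y in nhds x, DifferentiableAt ℝ F y) ∧ DifferentiableAt ℝ (gradient F) x

/-- The smallest real eigenvalue (used for self-adjoint maps). -/
def lambdaMin {d : ℕ} (A : Eu d →L[ℝ] Eu d) : ℝ :=
  sInf {μ : ℝ | Module.End.HasEigenvalue (A : Eu d →ₗ[ℝ] Eu d) μ}

/-- The largest real eigenvalue (used for self-adjoint maps). -/
def lambdaMax {d : ℕ} (A : Eu d →L[ℝ] Eu d) : ℝ :=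
  sSup {μ : ℝ | Module.End.HasEigenvalue (A : Eu d →ₗ[ℝ] Eu d) μ}

/-- `x` is an `ε`-second-order stationary point of `F`. -/
def IsSecondOrderStationary {d : ℕ} (F : Eu d → ℝ) (ρ ε : ℝ) (x : Eu d) : Prop :=
  TwiceDifferentiableAt F x ∧ ‖gradient F x‖ ≤ ε ∧ -√(ρ * ε) < lambdaMin (hessian F x)

/-- `x` is an `ε`-approximate local minimum for the envelope `F` and the update map `S`
with step size `η`. -/
def IsApproxLocalMin {d : ℕ} (F : Eu d → ℝ) (S : Eu d → Eu d) (η ρ ε : ℝ) (x : Eu d) : Prop :=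
  ‖gradient F x‖ ≤ ε ∧ DifferentiableAt ℝ S x ∧ lambdaMax (fderiv ℝ S x) < 1 + η * √(ρ * ε)

/-- Around every point with gradient of norm at most `ε` (in particular around every critical
point), on the ball of radius `s`, `F` is twice differentiable with `ρ`-Lipschitz Hessian. -/
def HessianLipschitzNearCritical {d : ℕ} (F : Eu d → ℝ) (ρ ε s : ℝ) : Prop :=
  ∀ x, ‖gradient F x‖ ≤ ε →
    (∀ y ∈ Metric.ball x s, TwiceDifferentiableAt F y) ∧
    ∀ y ∈ Metric.ball x s, ∀ z ∈ Metric.ball x s, ‖hessian F y - hessian F z‖ ≤ ρ * ‖y - z‖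

/-! The parameters. -/

/-- The perturbation radius `r`. -/
def pertRadius (ε ι : ℝ) : ℝ := ε / (400 * ι ^ 3)

/-- The time interval between perturbations. -/
def pertInterval (lam ρ ε ι : ℝ) : ℝ := 1 / (lam * √(ρ * ε)) * ι

/-- The function decrease. -/
def decrease (ρ ε ι : ℝ) : ℝ := 1 / (50 * ι ^ 3) * √(ε ^ 3 / ρ)

/-- The localization radius. -/
def locRadius (ρ ε ι : ℝ) : ℝ := 1 / (4 * ι) * √(ε / ρ)

/-- The number `T` of iterations (a real number), where `Δ` is the initial optimality gap. -/
def numIter (lam ρ ε ι Δ : ℝ) : ℝ :=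
  4 * max (Δ / (decrease ρ ε ι / (2 * pertInterval lam ρ ε ι))) (Δ / (lam * ε ^ 2 / 2))

/-- The initial optimality gap `F x₀ - F*`. -/
def gap {d : ℕ} (F : Eu d → ℝ) (x₀ : Eu d) : ℝ := F x₀ - ⨅ x, F x

/-! The algorithm. Its state consists of the current iterate and of the last perturbation time. -/

open scoped Classical in
/-- The perturbation at time `t`: if `‖g x‖ ≤ ε` and `t - t_perturb > τ`, then `x` becomes
`x - η v` and `t_perturb` becomes `t`. -/
def perturb {d : ℕ} (g : Eu d → Eu d) (η τ ε : ℝ) (v : Eu d) (t : ℕ) (s : Eu d × ℕ) :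
    Eu d × ℕ :=
  if ‖g s.1‖ ≤ ε ∧ τ < (t : ℝ) - (s.2 : ℝ) then (s.1 - η • v, t) else s

/-- The state at the beginning of round `t`, for the noise sequence `ξ` and the update map `S`. -/
def state {d : ℕ} (S g : Eu d → Eu d) (η τ ε : ℝ) (x₀ : Eu d) (ξ : ℕ → Eu d) : ℕ → Eu d × ℕ
  | 0 => (x₀, 0)
  | t + 1 =>
    let s := perturb g η τ ε (ξ t) t (state S g η τ ε x₀ ξ t)
    (S s.1, s.2)

/-- The iterate `x_t` before the possible perturbation of round `t`. -/
def iterate {d : ℕ} (S g : Eu d → Eu d) (η τ ε : ℝ) (x₀ : Eu d) (ξ : ℕ → Eu d) (t : ℕ) : Eu d :=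
  (state S g η τ ε x₀ ξ t).1

/-- The iterate `x_t` after the possible perturbation of round `t`. -/
def iteratePost {d : ℕ} (S g : Eu d → Eu d) (η τ ε : ℝ) (x₀ : Eu d) (ξ : ℕ → Eu d) (t : ℕ) :
    Eu d :=
  (perturb g η τ ε (ξ t) t (state S g η τ ε x₀ ξ t)).1

/-- `x` satisfies the second-order condition for the envelope and is an `ε`-approximate local
minimum for the proximal map with step size `lam`. -/
def Good {d : ℕ} (f : Eu d → EReal) (lam ρ ε : ℝ) (x : Eu d) : Prop :=
  IsSecondOrderStationary (moreau f lam) ρ ε x ∧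
    IsApproxLocalMin (moreau f lam) (prox f lam) lam ρ ε x

/-- At least half of the first `N` iterates of the perturbed proximal point algorithm with step
size `η = lam` are good, both before and after the perturbation of their round. -/
def HalfGood {d : ℕ} (f : Eu d → EReal) (lam ρ ε ι : ℝ) (x₀ : Eu d) (ξ : ℕ → Eu d) (N : ℕ) :
    Prop :=
  (N : ℝ) / 2 ≤ (Set.ncard {t : ℕ | t < N ∧
    Good f lam ρ ε (iterate (prox f lam) (gradient (moreau f lam)) lam
      (pertInterval lam ρ ε ι) ε x₀ ξ t) ∧
    Good f lam ρ ε (iteratePost (prox f lam) (gradient (moreau f lam)) lam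
      (pertInterval lam ρ ε ι) ε x₀ ξ t)} : ℝ)

end PerturbedProx

end

/-!
For `2 * ell * lam ≤ 1` the envelope `F` of `f` is differentiable with `lam⁻¹`-Lipschitz gradient,
and `prox f lam x = x - lam • ∇F x`; so the algorithm is perturbed gradient descent on `F`. By the
descent lemma a round with large gradient decreases `F` by at least `lam * ε² / 2`. At a point with
small gradient and a Hessian eigenvalue at most `-√(ρ * ε) / 2`, consider the perturbations after
which gradient descent stays close without decreasing `F`. Two of them that differ by a multiple of
a least eigenvector must be close, because their difference is amplified geometrically; so by
Fubini they have small volume, and by a union bound, with high probability no round draws one of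
them. Every bad round is then paid for by a decrease of `F`, of which only
`F x₀ - ⨅ x, F x` is available.
-/

noncomputable section

namespace PerturbedProx

open MeasureTheory ProbabilityTheory Module

/-! ### The Moreau envelope of a weakly convex function -/

section QuadraticBounds

variable {E : Type*} [NormedAddCommGroup E] [InnerProductSpace ℝ E]

lemma norm_combo_sq (s : ℝ) (a b : E) :
    ‖(1 - s) • a + s • b‖ ^ 2 =
      (1 - s) * ‖a‖ ^ 2 + s * ‖b‖ ^ 2 - s * (1 - s) * ‖a - b‖ ^ 2 := by
  simp only [@norm_add_sq_real, @norm_sub_sq_real, norm_smul, real_inner_smul_left,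
    real_inner_smul_right, mul_pow, Real.norm_eq_abs, sq_abs]
  ring

lemma hasGradientAt_of_le_quadratic [CompleteSpace E] {F : E → ℝ} {G : E → E} {C L : ℝ}
    (hF : ∀ x y, F y ≤ F x + inner ℝ (G x) (y - x) + C * ‖y - x‖ ^ 2)
    (hG : ∀ x y, ‖G x - G y‖ ≤ L * ‖x - y‖) (x : E) : HasGradientAt F (G x) x := by
  rw [hasGradientAt_iff_isLittleO]
  have hO : (fun y => F y - F x - inner ℝ (G x) (y - x)) =O[nhds x] fun y => ‖y - x‖ ^ 2 := by
    refine Asymptotics.IsBigO.of_bound (|C| + |L|) (Filter.Eventually.of_forall fun y => ?_)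
    have hup : F y - F x - inner ℝ (G x) (y - x) ≤ C * ‖y - x‖ ^ 2 := by linarith [hF x y]
    have hswap : inner ℝ (G y - G x) (y - x) - C * ‖y - x‖ ^ 2 ≤
        F y - F x - inner ℝ (G x) (y - x) := by
      have hyx := hF y x
      rw [← neg_sub y x, inner_neg_right, norm_neg] at hyx
      rw [inner_sub_left]
      linarith
    have hinner : -(L * ‖y - x‖ ^ 2) ≤ inner ℝ (G y - G x) (y - x) :=
      neg_le_of_abs_le ((abs_real_inner_le_norm _ _).trans
        (by nlinarith [hG y x, norm_nonneg (y - x)]))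
    have hC : C * ‖y - x‖ ^ 2 ≤ |C| * ‖y - x‖ ^ 2 := by gcongr; exact le_abs_self C
    have hL : L * ‖y - x‖ ^ 2 ≤ |L| * ‖y - x‖ ^ 2 := by gcongr; exact le_abs_self L
    have hL₀ : 0 ≤ |L| * ‖y - x‖ ^ 2 := by positivity
    rw [norm_pow, norm_norm, Real.norm_eq_abs, abs_le]
    constructor <;> linarith
  exact hO.trans_isLittleO (by simpa using Asymptotics.isLittleO_pow_sub_sub x one_lt_two)

end QuadraticBounds

lemma exists_forall_le_of_isBounded_preimage_Iic {X γ : Type*} [PseudoMetricSpace X]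
    [ProperSpace X] [LinearOrder γ] {φ : X → γ} (hφ : LowerSemicontinuous φ) (x₀ : X)
    (hb : Bornology.IsBounded (φ ⁻¹' Set.Iic (φ x₀))) : ∃ p, ∀ y, φ p ≤ φ y := by
  obtain ⟨p, hp, hmin⟩ := (hφ.lowerSemicontinuousOn _).exists_isMinOn
    (s := φ ⁻¹' Set.Iic (φ x₀)) ⟨x₀, le_rfl⟩
    (Metric.isCompact_of_isClosed_isBounded (hφ.isClosed_preimage _) hb)
  refine ⟨p, fun y => ?_⟩
  rcases le_total (φ y) (φ x₀) with hy | hy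
  · exact hmin hy
  · exact le_trans hp hy

lemma exists_real_le_of_isCompact {X : Type*} [TopologicalSpace X] {φ : X → EReal} {K : Set X}
    (hφ : LowerSemicontinuous φ) (hbot : ∀ x, φ x ≠ ⊥) (hK : IsCompact K) :
    ∃ m : ℝ, ∀ x ∈ K, (m : EReal) ≤ φ x := by
  rcases K.eq_empty_or_nonempty with rfl | hne
  · simp
  obtain ⟨z, -, hz⟩ := (hφ.lowerSemicontinuousOn K).exists_isMinOn hne hK
  obtain ⟨m, -, hm⟩ := EReal.lt_iff_exists_real_btwn.1 (bot_lt_iff_ne_bot.2 (hbot z))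
  exact ⟨m, fun x hx => hm.le.trans (hz hx)⟩

section Moreau

variable {d : ℕ} {f : Eu d → EReal} {ell lam : ℝ}

lemma WeaklyConvex.apply_combo_le (h : WeaklyConvex f ell) {a b : Eu d} {α β s : ℝ}
    (ha : f a ≤ (α : EReal)) (hb : f b ≤ (β : EReal)) (hs₀ : 0 ≤ s) (hs₁ : s ≤ 1) :
    f ((1 - s) • a + s • b) ≤
      (((1 - s) * α + s * β + ell / 2 * (s * (1 - s) * ‖a - b‖ ^ 2) : ℝ) : EReal) := by
  have mem_epigraph : ∀ {y : Eu d} {γ : ℝ}, f y ≤ (γ : EReal) →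
      (y, γ + ell / 2 * ‖y‖ ^ 2) ∈
        {p : Eu d × ℝ | f p.1 + ((ell / 2 * ‖p.1‖ ^ 2 : ℝ) : EReal) ≤ (p.2 : EReal)} := by
    intro y γ hy
    simp only [Set.mem_ofPred_eq]
    rw [EReal.coe_add]
    gcongr
  have hcombo := h (mem_epigraph ha) (mem_epigraph hb) (sub_nonneg.2 hs₁) hs₀ (by ring)
  simp only [Set.mem_ofPred_eq, Prod.smul_mk, Prod.mk_add_mk, smul_eq_mul] at hcombo
  rw [← EReal.le_sub_iff_add_le (Or.inl (EReal.coe_ne_bot _)) (Or.inl (EReal.coe_ne_top _)),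
    ← EReal.coe_sub] at hcombo
  refine hcombo.trans (EReal.coe_le_coe_iff.2 (le_of_eq ?_))
  rw [norm_combo_sq]
  ring

lemma proxObjective_le_coe_iff {x y : Eu d} {α : ℝ} :
    proxObjective f lam x y ≤ (α : EReal) ↔
      f y ≤ ((α - 1 / (2 * lam) * ‖y - x‖ ^ 2 : ℝ) : EReal) := by
  unfold proxObjective
  rw [← EReal.le_sub_iff_add_le (Or.inl (EReal.coe_ne_bot _)) (Or.inl (EReal.coe_ne_top _)),
    ← EReal.coe_sub]

lemma WeaklyConvex.proxObjective_combo_le (h : WeaklyConvex f ell) {x a b : Eu d} {α β s : ℝ}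
    (ha : proxObjective f lam x a ≤ (α : EReal)) (hb : proxObjective f lam x b ≤ (β : EReal))
    (hs₀ : 0 ≤ s) (hs₁ : s ≤ 1) :
    proxObjective f lam x ((1 - s) • a + s • b) ≤
      (((1 - s) * α + s * β - (lam⁻¹ - ell) / 2 * (s * (1 - s) * ‖a - b‖ ^ 2) : ℝ) : EReal) := by
  rw [proxObjective_le_coe_iff] at *
  refine (h.apply_combo_le ha hb hs₀ hs₁).trans (EReal.coe_le_coe_iff.2 (le_of_eq ?_))
  have hshift : (1 - s) • a + s • b - x = (1 - s) • (a - x) + s • (b - x) := by module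
  rw [hshift, norm_combo_sq, sub_sub_sub_cancel_right, one_div, mul_inv]
  ring

lemma lowerSemicontinuous_proxObjective (hf : LowerSemicontinuous f) (x : Eu d) :
    LowerSemicontinuous (proxObjective f lam x) := by
  refine hf.add' ?_ fun y =>
    EReal.continuousAt_add (Or.inr (EReal.coe_ne_bot _)) (Or.inr (EReal.coe_ne_top _))
  exact (continuous_coe_real_ereal.comp (by fun_prop)).lowerSemicontinuous

lemma ClosedProper.proxObjective_ne_bot (hf : ClosedProper f) (x y : Eu d) :
    proxObjective f lam x y ≠ ⊥ := by
  simp only [proxObjective, Ne, EReal.add_eq_bot_iff, hf.ne_bot y, EReal.coe_ne_bot, or_self,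
    not_false_eq_true]

lemma ClosedProper.exists_proxObjective_ne_top (hf : ClosedProper f) (x : Eu d) :
    ∃ y, proxObjective f lam x y ≠ ⊤ :=
  let ⟨y, hy⟩ := hf.proper
  ⟨y, EReal.add_ne_top hy (EReal.coe_ne_top _)⟩

lemma isBounded_preimage_proxObjective (hf : ClosedProper f) (h : WeaklyConvex f ell)
    (hμ : ell < lam⁻¹) (x : Eu d) (α : ℝ) :
    Bornology.IsBounded (proxObjective f lam x ⁻¹' Set.Iic (α : EReal)) := by
  rcases (proxObjective f lam x ⁻¹' Set.Iic (α : EReal)).eq_empty_or_nonempty with hemp | ⟨a, ha⟩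
  · simp [hemp]
  obtain ⟨m, hm⟩ := exists_real_le_of_isCompact
    (lowerSemicontinuous_proxObjective (lam := lam) hf.lsc x)
    (hf.proxObjective_ne_bot x) (isCompact_closedBall a 1)
  refine (Metric.isBounded_closedBall (x := a)
    (r := max 1 (1 + 2 * (α - m) / (lam⁻¹ - ell)))).subset fun y hy => ?_
  rw [Metric.mem_closedBall, dist_eq_norm, le_max_iff, or_iff_not_imp_left, not_le]
  intro hfar
  set R := ‖y - a‖ with hR
  have hmem : (1 - R⁻¹) • a + R⁻¹ • y ∈ Metric.closedBall a 1 := by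
    have hdiff : (1 - R⁻¹) • a + R⁻¹ • y - a = R⁻¹ • (y - a) := by module
    rw [mem_closedBall_iff_norm, hdiff, norm_smul, norm_inv, norm_norm, ← hR,
      inv_mul_cancel₀ (by positivity)]
  have hle := (hm _ hmem).trans
    (h.proxObjective_combo_le ha hy (by positivity) (inv_le_one_of_one_le₀ hfar.le))
  have hcoef : R⁻¹ * (1 - R⁻¹) * R ^ 2 = R - 1 := by field_simp
  rw [EReal.coe_le_coe_iff, norm_sub_rev, ← hR, hcoef] at hle
  have hbound : R - 1 ≤ 2 * (α - m) / (lam⁻¹ - ell) := by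
    rw [le_div_iff₀ (sub_pos.2 hμ)]
    linarith
  linarith

lemma proxObjective_prox_le (hf : ClosedProper f) (h : WeaklyConvex f ell) (hμ : ell < lam⁻¹)
    (x y : Eu d) : proxObjective f lam x (prox f lam x) ≤ proxObjective f lam x y := by
  refine Classical.epsilon_spec (p := fun p => ∀ y, proxObjective f lam x p ≤
    proxObjective f lam x y) ?_ y
  obtain ⟨a, ha⟩ := hf.exists_proxObjective_ne_top (lam := lam) x
  refine exists_forall_le_of_isBounded_preimage_Iic
    (lowerSemicontinuous_proxObjective hf.lsc x) a ?_
  rw [← EReal.coe_toReal ha (hf.proxObjective_ne_bot x a)]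
  exact isBounded_preimage_proxObjective hf h hμ x _

lemma proxObjective_prox (hf : ClosedProper f) (h : WeaklyConvex f ell) (hμ : ell < lam⁻¹)
    (x : Eu d) : proxObjective f lam x (prox f lam x) = (moreau f lam x : EReal) := by
  have hinf : ⨅ y, proxObjective f lam x y = proxObjective f lam x (prox f lam x) :=
    le_antisymm (iInf_le _ _) (le_iInf (proxObjective_prox_le hf h hμ x))
  obtain ⟨a, ha⟩ := hf.exists_proxObjective_ne_top (lam := lam) x
  rw [moreau, hinf, EReal.coe_toReal
    (ne_top_of_le_ne_top ha (proxObjective_prox_le hf h hμ x a)) (hf.proxObjective_ne_bot _ _)]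

lemma moreau_add_le (hf : ClosedProper f) (h : WeaklyConvex f ell) (hμ : ell < lam⁻¹)
    {x y : Eu d} {β : ℝ} (hβ : proxObjective f lam x y ≤ (β : EReal)) :
    moreau f lam x + (lam⁻¹ - ell) / 2 * ‖prox f lam x - y‖ ^ 2 ≤ β := by
  set A := (lam⁻¹ - ell) / 2 * ‖prox f lam x - y‖ ^ 2 with hA
  have hsegment : ∀ s ∈ Set.Ioc (0 : ℝ) 1, moreau f lam x + (1 - s) * A ≤ β := by
    rintro s ⟨hs₀, hs₁⟩
    have hmin := (proxObjective_prox hf h hμ x).ge.trans ((proxObjective_prox_le hf h hμ x _).trans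
      (h.proxObjective_combo_le (proxObjective_prox hf h hμ x).le hβ hs₀.le hs₁))
    rw [EReal.coe_le_coe_iff] at hmin
    refine le_of_mul_le_mul_left ?_ hs₀
    rw [hA]
    linarith
  have hlim : Filter.Tendsto (fun s : ℝ => moreau f lam x + (1 - s) * A)
      (nhdsWithin 0 (Set.Ioi 0)) (nhds (moreau f lam x + (1 - 0) * A)) :=
    (Continuous.tendsto (by fun_prop) 0).mono_left nhdsWithin_le_nhds
  simpa using le_of_tendsto hlim
    (Filter.eventually_of_mem (Ioc_mem_nhdsGT one_pos) hsegment)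

lemma moreau_add_le_moreau_add (hf : ClosedProper f) (h : WeaklyConvex f ell) (hμ : ell < lam⁻¹)
    (x y : Eu d) :
    moreau f lam y + (lam⁻¹ - ell) / 2 * ‖prox f lam y - prox f lam x‖ ^ 2 ≤
      moreau f lam x + 1 / (2 * lam) * (‖prox f lam x - y‖ ^ 2 - ‖prox f lam x - x‖ ^ 2) := by
  refine moreau_add_le hf h hμ (proxObjective_le_coe_iff.2 ?_)
  refine (proxObjective_le_coe_iff.1 (proxObjective_prox hf h hμ x).le).trans
    (EReal.coe_le_coe_iff.2 (le_of_eq ?_))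
  ring

lemma norm_sub_prox_sub_le (hf : ClosedProper f) (h : WeaklyConvex f ell) (hlam : 0 < lam)
    (hell : 2 * ell ≤ lam⁻¹) (x y : Eu d) :
    ‖(x - prox f lam x) - (y - prox f lam y)‖ ≤ ‖x - y‖ := by
  have hinv : 0 < lam⁻¹ := inv_pos.2 hlam
  have hμ : ell < lam⁻¹ := by linarith
  have hxy := moreau_add_le_moreau_add hf h hμ x y
  have hyx := moreau_add_le_moreau_add hf h hμ y x
  rw [show 1 / (2 * lam) = lam⁻¹ / 2 by field_simp] at hxy hyx
  generalize lam⁻¹ = κ at *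
  set p := prox f lam x
  set q := prox f lam y
  rw [norm_sub_rev q p] at hxy
  have hinner : (‖p - y‖ ^ 2 - ‖p - x‖ ^ 2) + (‖q - x‖ ^ 2 - ‖q - y‖ ^ 2) =
      2 * inner ℝ (p - q) (x - y) := by
    simp only [@norm_sub_sq_real, inner_sub_left, inner_sub_right]
    ring
  have hmono : ‖p - q‖ ^ 2 ≤ 2 * inner ℝ (p - q) (x - y) := by
    have hmod : κ / 2 * ‖p - q‖ ^ 2 ≤ (κ - ell) * ‖p - q‖ ^ 2 := by
      gcongr
      linarith
    refine le_of_mul_le_mul_left ?_ (half_pos hinv)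
    rw [← hinner]
    linarith
  rw [← sq_le_sq₀ (norm_nonneg _) (norm_nonneg _), sub_sub_sub_comm, @norm_sub_sq_real,
    real_inner_comm]
  linarith

lemma moreau_le_quadratic (hf : ClosedProper f) (h : WeaklyConvex f ell) (hμ : ell < lam⁻¹)
    (x y : Eu d) :
    moreau f lam y ≤ moreau f lam x + inner ℝ (lam⁻¹ • (x - prox f lam x)) (y - x) +
      1 / (2 * lam) * ‖y - x‖ ^ 2 := by
  have hgrowth := moreau_add_le_moreau_add hf h hμ x y
  have hdrop : 0 ≤ (lam⁻¹ - ell) / 2 * ‖prox f lam y - prox f lam x‖ ^ 2 :=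
    mul_nonneg (by linarith) (sq_nonneg _)
  set p := prox f lam x
  have hexpand : ‖p - y‖ ^ 2 = ‖p - x‖ ^ 2 + 2 * inner ℝ (x - p) (y - x) + ‖y - x‖ ^ 2 := by
    rw [← sub_sub_sub_cancel_right p y x, @norm_sub_sq_real, ← neg_sub p x, inner_neg_left]
    ring
  rw [hexpand, one_div, mul_inv] at hgrowth
  rw [real_inner_smul_left, one_div, mul_inv]
  linarith

lemma hasGradientAt_moreau (hf : ClosedProper f) (h : WeaklyConvex f ell) (hlam : 0 < lam)
    (hell : 2 * ell ≤ lam⁻¹) (x : Eu d) :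
    HasGradientAt (moreau f lam) (lam⁻¹ • (x - prox f lam x)) x := by
  refine hasGradientAt_of_le_quadratic (G := fun x => lam⁻¹ • (x - prox f lam x)) (L := lam⁻¹)
    (moreau_le_quadratic hf h (by linarith [inv_pos.2 hlam])) (fun x y => ?_) x
  rw [← smul_sub, norm_smul, Real.norm_of_nonneg (inv_pos.2 hlam).le]
  gcongr
  exact norm_sub_prox_sub_le hf h hlam hell x y

end Moreau

/-! ### Smooth functions and gradient steps -/

section Smooth

variable {E : Type*} [NormedAddCommGroup E] [InnerProductSpace ℝ E] [CompleteSpace E]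
  {F : E → ℝ} {lam : ℝ}

lemma le_add_of_inner_gradient_sub_le (hF : Differentiable ℝ F) {x v : E} {C : ℝ}
    (h : ∀ t ∈ Set.Ioo (0 : ℝ) 1,
      inner ℝ (gradient F (x + t • v) - gradient F x) v ≤ C * t) :
    F (x + v) ≤ F x + inner ℝ (gradient F x) v + C / 2 := by
  set ψ : ℝ → ℝ := fun t => F (x + t • v) - inner ℝ (gradient F x) v * t - C / 2 * t ^ 2 with hψ
  have hderiv : ∀ t, HasDerivAt ψ
      (inner ℝ (gradient F (x + t • v)) v - inner ℝ (gradient F x) v - C * t) t := by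
    intro t
    have hline : HasDerivAt (fun t : ℝ => x + t • v) v t := by
      simpa using ((hasDerivAt_id t).smul_const v).const_add x
    have hF_line : HasDerivAt (fun t : ℝ => F (x + t • v))
        (inner ℝ (gradient F (x + t • v)) v) t := by
      simpa using! (hF (x + t • v)).hasGradientAt.hasFDerivAt.comp_hasDerivAt t hline
    exact ((hF_line.sub (hasDerivAt_const_mul _)).sub
      ((hasDerivAt_pow 2 t).const_mul (C / 2))).congr_deriv (by simp; ring)
  have hanti : AntitoneOn ψ (Set.Icc 0 1) := by
    refine antitoneOn_of_deriv_nonpos (convex_Icc 0 1)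
      (fun t _ => (hderiv t).continuousAt.continuousWithinAt)
      (fun t _ => (hderiv t).differentiableAt.differentiableWithinAt) fun t ht => ?_
    rw [interior_Icc] at ht
    rw [(hderiv t).deriv, ← inner_sub_left]
    linarith [h t ht]
  have hends := hanti (Set.left_mem_Icc.2 zero_le_one) (Set.right_mem_Icc.2 zero_le_one) zero_le_one
  simp only [hψ, zero_smul, add_zero, one_smul] at hends
  linarith

/-- The function `F` is differentiable and its gradient is `1 / lam`-Lipschitz, i.e. `lam` is an
admissible step size for gradient descent on `F`. -/
structure IsSmoothWith (F : E → ℝ) (lam : ℝ) : Prop where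
  pos : 0 < lam
  differentiable : Differentiable ℝ F
  norm_gradient_sub_le : ∀ x y, lam * ‖gradient F x - gradient F y‖ ≤ ‖x - y‖

/-- One step of gradient descent on `F` with step size `lam`. -/
def gradStep (F : E → ℝ) (lam : ℝ) (x : E) : E := x - lam • gradient F x

namespace IsSmoothWith

lemma lipschitzWith_gradient (hF : IsSmoothWith F lam) :
    LipschitzWith (Real.toNNReal lam⁻¹) (gradient F) :=
  LipschitzWith.of_dist_le_mul fun x y => by
    rw [dist_eq_norm, dist_eq_norm, Real.coe_toNNReal _ (inv_pos.2 hF.pos).le, inv_mul_eq_div,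
      le_div_iff₀' hF.pos]
    exact hF.norm_gradient_sub_le x y

lemma continuous_gradStep (hF : IsSmoothWith F lam) : Continuous (gradStep F lam) :=
  continuous_id.sub (hF.lipschitzWith_gradient.continuous.const_smul lam)

lemma le_quadratic (hF : IsSmoothWith F lam) (x v : E) :
    F (x + v) ≤ F x + inner ℝ (gradient F x) v + 1 / (2 * lam) * ‖v‖ ^ 2 := by
  have hlam := hF.pos
  have hle := le_add_of_inner_gradient_sub_le hF.differentiable (x := x) (v := v)
    (C := ‖v‖ ^ 2 / lam) fun t ht => by
      have hlip := hF.norm_gradient_sub_le (x + t • v) x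
      rw [add_sub_cancel_left, norm_smul, Real.norm_of_nonneg ht.1.le] at hlip
      refine (real_inner_le_norm _ _).trans ?_
      rw [div_mul_eq_mul_div, le_div_iff₀ hlam]
      nlinarith [norm_nonneg v]
  refine hle.trans_eq ?_
  field_simp

lemma apply_gradStep_le (hF : IsSmoothWith F lam) (x : E) :
    F (gradStep F lam x) ≤ F x - lam / 2 * ‖gradient F x‖ ^ 2 := by
  have hlam := hF.pos
  have hle := hF.le_quadratic x (-(lam • gradient F x))
  rw [← sub_eq_add_neg, inner_neg_right, real_inner_smul_right, real_inner_self_eq_norm_sq,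
    norm_neg, norm_smul, Real.norm_of_nonneg hlam.le] at hle
  refine hle.trans_eq ?_
  field_simp
  ring

lemma apply_gradStep_le_self (hF : IsSmoothWith F lam) (x : E) : F (gradStep F lam x) ≤ F x :=
  (hF.apply_gradStep_le x).trans
    (sub_le_self _ (mul_nonneg (half_pos hF.pos).le (sq_nonneg _)))

lemma antitone_apply_iterate (hF : IsSmoothWith F lam) (y : E) :
    Antitone fun j => F ((gradStep F lam)^[j] y) :=
  antitone_nat_of_succ_le fun j => by
    rw [Function.iterate_succ_apply']
    exact hF.apply_gradStep_le_self _

lemma norm_iterate_sub_sq_le (hF : IsSmoothWith F lam) (y : E) (j : ℕ) :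
    ‖(gradStep F lam)^[j] y - y‖ ^ 2 ≤ j * (2 * lam * (F y - F ((gradStep F lam)^[j] y))) := by
  set Y : ℕ → E := fun i => (gradStep F lam)^[i] y with hY
  have hstep : ∀ i, ‖Y (i + 1) - Y i‖ ^ 2 ≤ 2 * lam * (F (Y i) - F (Y (i + 1))) := by
    intro i
    have hdescent := hF.apply_gradStep_le (Y i)
    have hdiff : gradStep F lam (Y i) - Y i = -(lam • gradient F (Y i)) := by
      rw [gradStep, sub_sub_cancel_left]
    simp only [hY, Function.iterate_succ_apply'] at hdescent hdiff ⊢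
    rw [hdiff, norm_neg, norm_smul, Real.norm_of_nonneg hF.pos.le, mul_pow]
    nlinarith [hF.pos]
  calc ‖Y j - Y 0‖ ^ 2
      = ‖∑ i ∈ Finset.range j, (Y (i + 1) - Y i)‖ ^ 2 := by rw [Finset.sum_range_sub]
    _ ≤ (∑ i ∈ Finset.range j, ‖Y (i + 1) - Y i‖) ^ 2 := by gcongr; exact norm_sum_le _ _
    _ ≤ j * ∑ i ∈ Finset.range j, ‖Y (i + 1) - Y i‖ ^ 2 := by
      simpa using sq_sum_le_card_mul_sum_sq (s := Finset.range j)
        (f := fun i => ‖Y (i + 1) - Y i‖)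
    _ ≤ j * ∑ i ∈ Finset.range j, 2 * lam * (F (Y i) - F (Y (i + 1))) := by
      gcongr with i
      exact hstep i
    _ = j * (2 * lam * (F (Y 0) - F (Y j))) := by
      rw [← Finset.mul_sum, Finset.sum_range_sub']

lemma apply_sub_smul_le (hF : IsSmoothWith F lam) {x v : E} {ε r : ℝ}
    (hx : ‖gradient F x‖ ≤ ε) (hv : ‖v‖ ≤ r) :
    F (x - lam • v) ≤ F x + lam * (ε * r + r ^ 2 / 2) := by
  have hlam := hF.pos
  have hquad := hF.le_quadratic x (-(lam • v))
  rw [← sub_eq_add_neg, inner_neg_right, real_inner_smul_right, norm_neg, norm_smul,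
    Real.norm_of_nonneg hlam.le] at hquad
  have hinner : -inner ℝ (gradient F x) v ≤ ε * r :=
    (neg_le_abs _).trans ((abs_real_inner_le_norm _ _).trans
      (mul_le_mul hx hv (norm_nonneg _) ((norm_nonneg _).trans hx)))
  have hsq : ‖v‖ ^ 2 ≤ r ^ 2 := by gcongr
  have hcoef : 1 / (2 * lam) * (lam * ‖v‖) ^ 2 = lam * (‖v‖ ^ 2 / 2) := by field_simp
  nlinarith

lemma apply_gradStep_sub_smul_le (hF : IsSmoothWith F lam) {x v : E} {r : ℝ} (hv : ‖v‖ ≤ r) :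
    F (gradStep F lam (x - lam • v)) ≤ F x + 2 * lam * r ^ 2 := by
  have hlam := hF.pos
  set y := x - lam • v with hy
  have hgrad : ‖gradient F x - gradient F y‖ ≤ r := by
    have hlip := hF.norm_gradient_sub_le x y
    rw [hy, sub_sub_cancel, norm_smul, Real.norm_of_nonneg hlam.le] at hlip
    exact (le_of_mul_le_mul_left hlip hlam).trans hv
  have hx : ‖gradient F x‖ ≤ ‖gradient F y‖ + r :=
    (norm_le_norm_add_norm_sub' _ (gradient F y)).trans (by gcongr)
  have hmove := hF.apply_sub_smul_le hx hv
  have hstep := hF.apply_gradStep_le y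
  nlinarith [mul_nonneg hlam.le (sq_nonneg (‖gradient F y‖ - r))]

lemma apply_gradStep_le_of_lt_norm_gradient (hF : IsSmoothWith F lam) {ε : ℝ} (hε : 0 ≤ ε) {x : E}
    (hx : ε < ‖gradient F x‖) : F (gradStep F lam x) ≤ F x - lam / 2 * ε ^ 2 := by
  have hlam := hF.pos
  refine (hF.apply_gradStep_le x).trans ?_
  gcongr

end IsSmoothWith

end Smooth

lemma isSmoothWith_moreau {d : ℕ} {f : Eu d → EReal} {ell lam : ℝ} (hf : ClosedProper f)
    (h : WeaklyConvex f ell) (hlam : 0 < lam) (hell : 2 * ell ≤ lam⁻¹) :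
    IsSmoothWith (moreau f lam) lam where
  pos := hlam
  differentiable x := (hasGradientAt_moreau hf h hlam hell x).differentiableAt
  norm_gradient_sub_le x y := by
    rw [(hasGradientAt_moreau hf h hlam hell x).gradient,
      (hasGradientAt_moreau hf h hlam hell y).gradient, ← smul_sub, norm_smul,
      Real.norm_of_nonneg (inv_pos.2 hlam).le, mul_inv_cancel_left₀ hlam.ne']
    exact norm_sub_prox_sub_le hf h hlam hell x y

lemma prox_eq_gradStep {d : ℕ} {f : Eu d → EReal} {ell lam : ℝ} (hf : ClosedProper f)
    (h : WeaklyConvex f ell) (hlam : 0 < lam) (hell : 2 * ell ≤ lam⁻¹) :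
    prox f lam = gradStep (moreau f lam) lam := by
  funext x
  rw [gradStep, (hasGradientAt_moreau hf h hlam hell x).gradient, smul_inv_smul₀ hlam.ne',
    sub_sub_cancel]

/-! ### Extreme eigenvalues and the Hessian -/

section Eigenvalues

variable {d : ℕ} {A : Eu d →L[ℝ] Eu d}

lemma lambdaMin_le {μ : ℝ} (h : End.HasEigenvalue (A : Eu d →ₗ[ℝ] Eu d) μ) : lambdaMin A ≤ μ :=
  csInf_le (End.finite_hasEigenvalue _).bddBelow h

lemma nonempty_hasEigenvalue (hd : 0 < d) (hA : (A : Eu d →ₗ[ℝ] Eu d).IsSymmetric) :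
    {μ : ℝ | End.HasEigenvalue (A : Eu d →ₗ[ℝ] Eu d) μ}.Nonempty :=
  ⟨_, hA.hasEigenvalue_eigenvalues finrank_euclideanSpace_fin ⟨0, hd⟩⟩

lemma exists_lambdaMin_eigenvector (hd : 0 < d) (hA : (A : Eu d →ₗ[ℝ] Eu d).IsSymmetric) :
    ∃ e : Eu d, ‖e‖ = 1 ∧ A e = lambdaMin A • e := by
  obtain ⟨v, hv⟩ := End.HasEigenvalue.exists_hasEigenvector
    ((nonempty_hasEigenvalue hd hA).csInf_mem (End.finite_hasEigenvalue _))
  have hAv : A v = lambdaMin A • v := hv.apply_eq_smul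
  exact ⟨‖v‖⁻¹ • v, norm_smul_inv_norm (𝕜 := ℝ) hv.2, by rw [map_smul, hAv, smul_comm]⟩

lemma lambdaMin_mul_le_inner (hA : (A : Eu d →ₗ[ℝ] Eu d).IsSymmetric) (x : Eu d) :
    lambdaMin A * ‖x‖ ^ 2 ≤ inner ℝ (A x) x := by
  have hn : finrank ℝ (Eu d) = d := finrank_euclideanSpace_fin
  have hdiag : ∀ i, (hA.eigenvectorBasis hn).repr (A x) i =
      hA.eigenvalues hn i * (hA.eigenvectorBasis hn).repr x i :=
    hA.eigenvectorBasis_apply_self_apply hn x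
  rw [← (hA.eigenvectorBasis hn).repr.inner_map_map (A x) x,
    ← (hA.eigenvectorBasis hn).repr.norm_map x, EuclideanSpace.real_norm_sq_eq, PiLp.inner_apply,
    Finset.mul_sum]
  refine Finset.sum_le_sum fun i _ => ?_
  rw [hdiag, Real.inner_apply, mul_assoc, ← sq]
  gcongr
  exact lambdaMin_le (hA.hasEigenvalue_eigenvalues hn i)

lemma norm_sub_smul_apply_le {η : ℝ} (hA : (A : Eu d →ₗ[ℝ] Eu d).IsSymmetric) (hη : 0 ≤ η)
    (hA_le : ∀ x, η * ‖A x‖ ≤ ‖x‖) (hmin : lambdaMin A ≤ 0) (x : Eu d) :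
    ‖x - η • A x‖ ≤ (1 - η * lambdaMin A) * ‖x‖ := by
  have hn : finrank ℝ (Eu d) = d := finrank_euclideanSpace_fin
  set b := hA.eigenvectorBasis hn
  set μ := hA.eigenvalues hn
  have hdiag : ∀ i, b.repr (A x) i = μ i * b.repr x i :=
    hA.eigenvectorBasis_apply_self_apply hn x
  have hμ_le : ∀ i, η * μ i ≤ 1 := fun i => by
    have hAb : A (b i) = μ i • b i := hA.apply_eigenvectorBasis hn i
    have hnorm := hA_le (b i)
    rw [hAb, norm_smul, b.norm_eq_one, mul_one, Real.norm_eq_abs] at hnorm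
    exact (mul_le_mul_of_nonneg_left (le_abs_self _) hη).trans hnorm
  have hμ_ge : ∀ i, η * lambdaMin A ≤ η * μ i := fun i =>
    mul_le_mul_of_nonneg_left (lambdaMin_le (hA.hasEigenvalue_eigenvalues hn i)) hη
  have hfactor : 0 ≤ 1 - η * lambdaMin A := by nlinarith
  rw [← sq_le_sq₀ (norm_nonneg _) (by positivity), mul_pow, ← b.repr.norm_map,
    ← b.repr.norm_map x, EuclideanSpace.real_norm_sq_eq, EuclideanSpace.real_norm_sq_eq,
    Finset.mul_sum]
  refine Finset.sum_le_sum fun i _ => ?_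
  have hcoord : b.repr (x - η • A x) i = (1 - η * μ i) * b.repr x i := by
    rw [map_sub, map_smul, PiLp.sub_apply, PiLp.smul_apply, hdiag, smul_eq_mul]
    ring
  rw [hcoord, mul_pow]
  gcongr ?_ * _
  exact pow_le_pow_left₀ (by linarith [hμ_le i]) (by linarith [hμ_ge i]) 2

lemma lambdaMax_id_sub_smul_le (hd : 0 < d) {η : ℝ} (hA : (A : Eu d →ₗ[ℝ] Eu d).IsSymmetric)
    (hη : 0 < η) :
    lambdaMax (ContinuousLinearMap.id ℝ (Eu d) - η • A) ≤ 1 - η * lambdaMin A := by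
  have hsymm : ((ContinuousLinearMap.id ℝ (Eu d) - η • A : Eu d →L[ℝ] Eu d) :
      Eu d →ₗ[ℝ] Eu d).IsSymmetric :=
    LinearMap.IsSymmetric.id.sub (hA.smul (conj_trivial η))
  refine csSup_le (nonempty_hasEigenvalue hd hsymm) fun κ hκ => ?_
  obtain ⟨v, hv⟩ := End.HasEigenvalue.exists_hasEigenvector hκ
  have hκv : v - η • A v = κ • v := hv.apply_eq_smul
  have hAv : A v = ((1 - κ) / η) • v := by
    rw [div_eq_inv_mul, mul_smul, eq_inv_smul_iff₀ hη.ne', sub_smul, one_smul, ← hκv,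
      sub_sub_cancel]
  have hmin : lambdaMin A ≤ (1 - κ) / η := lambdaMin_le
    (End.hasEigenvalue_of_hasEigenvector ⟨End.mem_eigenspace_iff.2 hAv, hv.2⟩)
  rw [le_div_iff₀ hη] at hmin
  linarith

end Eigenvalues

section Hessian

variable {d : ℕ} {F : Eu d → ℝ} {lam ρ ε s : ℝ}

lemma isSymmetric_hessian {x : Eu d} (h : TwiceDifferentiableAt F x) :
    (hessian F x : Eu d →ₗ[ℝ] Eu d).IsSymmetric := by
  have hfirst : ∀ᶠ y in nhds x, HasFDerivAt F (innerSL ℝ (gradient F y)) y := by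
    filter_upwards [h.1] with y hy
    exact hy.hasGradientAt.hasFDerivAt
  have hsecond : HasFDerivAt (fun y => innerSL ℝ (gradient F y))
      ((innerSL ℝ : Eu d →L[ℝ] Eu d →L[ℝ] ℝ).comp (hessian F x)) x :=
    (innerSL ℝ : Eu d →L[ℝ] Eu d →L[ℝ] ℝ).hasFDerivAt.comp x h.2.hasFDerivAt
  intro v w
  have hsymm := second_derivative_symmetric_of_eventually hfirst hsecond v w
  simp only [ContinuousLinearMap.comp_apply, innerSL_apply_apply] at hsymm
  rw [ContinuousLinearMap.coe_coe, hsymm, real_inner_comm]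

lemma hasFDerivAt_gradStep {x : Eu d} (h : TwiceDifferentiableAt F x) :
    HasFDerivAt (gradStep F lam) (ContinuousLinearMap.id ℝ (Eu d) - lam • hessian F x) x :=
  (hasFDerivAt_id x).sub (h.2.hasFDerivAt.const_smul lam)

lemma IsSmoothWith.norm_hessian_apply_le (hF : IsSmoothWith F lam) (x v : Eu d) :
    lam * ‖hessian F x v‖ ≤ ‖v‖ := by
  have hnorm : ‖hessian F x‖ ≤ lam⁻¹ := by
    simpa only [hessian, Real.coe_toNNReal _ (inv_pos.2 hF.pos).le] using
      norm_fderiv_le_of_lipschitz ℝ hF.lipschitzWith_gradient (x₀ := x)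
  have hv := (hessian F x).le_of_opNorm_le hnorm v
  rwa [inv_mul_eq_div, le_div_iff₀' hF.pos] at hv

/-- The first- and second-order conditions of an `ε`-second-order stationary point. Twice
differentiability is left out: it is part of the Hessian assumption once `‖∇F x‖ ≤ ε`. -/
def Settled (F : Eu d → ℝ) (ρ ε : ℝ) (x : Eu d) : Prop :=
  ‖gradient F x‖ ≤ ε ∧ -√(ρ * ε) < lambdaMin (hessian F x)

namespace HessianLipschitzNearCritical

lemma isSecondOrderStationary (hH : HessianLipschitzNearCritical F ρ ε s) (hs : 0 < s) {x : Eu d}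
    (hx : Settled F ρ ε x) : IsSecondOrderStationary F ρ ε x :=
  ⟨(hH x hx.1).1 x (Metric.mem_ball_self hs), hx⟩

lemma norm_gradient_sub_sub_le (hH : HessianLipschitzNearCritical F ρ ε s) (hρ : 0 ≤ ρ) {r : ℝ}
    (hrs : r ≤ s) {x y z : Eu d} (hx : ‖gradient F x‖ ≤ ε) (hy : y ∈ Metric.ball x r)
    (hz : z ∈ Metric.ball x r) :
    ‖gradient F y - gradient F z - hessian F x (y - z)‖ ≤ ρ * r * ‖y - z‖ := by
  obtain ⟨htwice, hlip⟩ := hH x hx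
  have hsub : Metric.ball x r ⊆ Metric.ball x s := Metric.ball_subset_ball hrs
  have hr : 0 < r := Metric.pos_of_mem_ball hy
  refine (convex_ball x r).norm_image_sub_le_of_norm_hasFDerivWithin_le'
    (f' := fun w => hessian F w)
    (fun w hw => (htwice w (hsub hw)).2.hasFDerivAt.hasFDerivWithinAt) (fun w hw => ?_) hz hy
  refine (hlip w (hsub hw) x (Metric.mem_ball_self (hr.trans_le hrs))).trans ?_
  gcongr
  exact (mem_ball_iff_norm.1 hw).le

lemma lambdaMin_le (hH : HessianLipschitzNearCritical F ρ ε s) (hd : 0 < d) (hρ : 0 ≤ ρ)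
    {x y : Eu d} (hx : ‖gradient F x‖ ≤ ε) (hy : y ∈ Metric.ball x s) :
    lambdaMin (hessian F x) ≤ lambdaMin (hessian F y) + ρ * s := by
  obtain ⟨htwice, hlip⟩ := hH x hx
  have hx_mem : x ∈ Metric.ball x s := Metric.mem_ball_self (Metric.pos_of_mem_ball hy)
  obtain ⟨e, he, hAe⟩ := exists_lambdaMin_eigenvector hd (isSymmetric_hessian (htwice y hy))
  have hop : ‖hessian F x - hessian F y‖ ≤ ρ * s := by
    refine (hlip x hx_mem y hy).trans ?_
    gcongr
    exact (mem_ball_iff_norm'.1 hy).le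
  calc lambdaMin (hessian F x)
      ≤ inner ℝ (hessian F x e) e := by
        simpa [he] using lambdaMin_mul_le_inner (isSymmetric_hessian (htwice x hx_mem)) e
    _ = lambdaMin (hessian F y) + inner ℝ ((hessian F x - hessian F y) e) e := by
        rw [_root_.sub_apply, inner_sub_left, hAe, real_inner_smul_left,
          real_inner_self_eq_norm_sq, he]
        ring
    _ ≤ lambdaMin (hessian F y) + ρ * s := by
        gcongr
        refine (real_inner_le_norm _ _).trans ?_
        simpa [he] using (hessian F x - hessian F y).le_of_opNorm_le hop e

lemma exists_le (hH : HessianLipschitzNearCritical F ρ ε s) (hd : 0 < d)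
    (hF : Differentiable ℝ F) (hρ : 0 ≤ ρ) {u : ℝ} (hu : 0 < u) (hus : u < s) {x : Eu d}
    (hx : ‖gradient F x‖ ≤ ε) :
    ∃ y, F y ≤ F x + (lambdaMin (hessian F x) + ρ * s) * u ^ 2 / 2 := by
  have hs : 0 < s := hu.trans hus
  obtain ⟨e₀, he₀, hAe₀⟩ := exists_lambdaMin_eigenvector hd
    (isSymmetric_hessian ((hH x hx).1 x (Metric.mem_ball_self hs)))
  set γ := lambdaMin (hessian F x)
  obtain ⟨e, he, hAe, hge⟩ : ∃ e : Eu d, ‖e‖ = 1 ∧ hessian F x e = γ • e ∧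
      inner ℝ (gradient F x) e ≤ 0 := by
    rcases le_total (inner ℝ (gradient F x) e₀) 0 with h | h
    · exact ⟨e₀, he₀, hAe₀, h⟩
    · exact ⟨-e₀, by simpa using he₀, by simp [hAe₀], by simpa [inner_neg_right] using h⟩
  have hbound : ∀ t ∈ Set.Ioo (0 : ℝ) 1, inner ℝ
      (gradient F (x + t • u • e) - gradient F x) (u • e) ≤ (γ + ρ * s) * u ^ 2 * t := by
    rintro t ⟨ht₀, ht₁⟩
    have htu : ‖t • u • e‖ = t * u := by
      rw [norm_smul, norm_smul, he, mul_one, Real.norm_of_nonneg ht₀.le, Real.norm_of_nonneg hu.le]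
    have hmem : x + t • u • e ∈ Metric.ball x s := by
      rw [mem_ball_iff_norm, add_sub_cancel_left, htu]
      nlinarith
    have hlin := hH.norm_gradient_sub_sub_le hρ le_rfl hx hmem (Metric.mem_ball_self hs)
    rw [add_sub_cancel_left, map_smul, map_smul, hAe, htu] at hlin
    have hcs := real_inner_le_norm
      (gradient F (x + t • u • e) - gradient F x - t • u • γ • e) e
    rw [he, mul_one, inner_sub_left, real_inner_smul_left, real_inner_smul_left,
      real_inner_smul_left, real_inner_self_eq_norm_sq, he] at hcs
    rw [real_inner_smul_right]
    nlinarith [hcs.trans hlin]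
  refine ⟨x + u • e, (le_add_of_inner_gradient_sub_le hF hbound).trans ?_⟩
  rw [real_inner_smul_right]
  nlinarith

end HessianLipschitzNearCritical

lemma good_of_settled (hd : 0 < d) {f : Eu d → EReal}
    (hprox : prox f lam = gradStep (moreau f lam) lam) (hlam : 0 < lam) (hs : 0 < s)
    (hH : HessianLipschitzNearCritical (moreau f lam) ρ ε s) {x : Eu d}
    (hx : Settled (moreau f lam) ρ ε x) : Good f lam ρ ε x := by
  have hstat := hH.isSecondOrderStationary hs hx
  have hderiv : HasFDerivAt (prox f lam)
      (ContinuousLinearMap.id ℝ (Eu d) - lam • hessian (moreau f lam) x) x :=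
    hprox ▸ hasFDerivAt_gradStep hstat.1
  refine ⟨hstat, hx.1, hderiv.differentiableAt, ?_⟩
  rw [hderiv.fderiv]
  refine (lambdaMax_id_sub_smul_le hd (isSymmetric_hessian hstat.1) hlam).trans_lt ?_
  nlinarith [hx.2]

end Hessian

/-! ### Separation of nearby gradient descent runs -/

section PowerIteration

variable {E : Type*} [NormedAddCommGroup E] [NormedSpace ℝ E] {B : E →L[ℝ] E} {G σ : ℝ}
  {u : ℕ → E} {m : ℕ}

lemma norm_sub_pow_smul_le (hG : 0 ≤ G) (hσ : 0 ≤ σ) (hB : ∀ x, ‖B x‖ ≤ G * ‖x‖)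
    (hu₀ : B (u 0) = G • u 0) (hu : ∀ j < m, ‖u (j + 1) - B (u j)‖ ≤ σ * ‖u j‖) :
    ‖u m - G ^ m • u 0‖ ≤ ((G + σ) ^ m - G ^ m) * ‖u 0‖ := by
  induction m with
  | zero => simp
  | succ m ih =>
    have hm := ih fun j hj => hu j (hj.trans m.lt_succ_self)
    set Q := u m - G ^ m • u 0 with hQ
    have hBQ : u (m + 1) - G ^ (m + 1) • u 0 = B Q + (u (m + 1) - B (u m)) := by
      rw [hQ, map_sub, map_smul, hu₀, smul_smul, ← pow_succ]
      abel
    have hu_le : ‖u m‖ ≤ ‖Q‖ + G ^ m * ‖u 0‖ := by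
      rw [← Real.norm_of_nonneg (pow_nonneg hG m), ← norm_smul]
      exact norm_le_norm_sub_add _ _
    calc ‖u (m + 1) - G ^ (m + 1) • u 0‖
        ≤ ‖B Q‖ + ‖u (m + 1) - B (u m)‖ := hBQ ▸ norm_add_le _ _
      _ ≤ G * ‖Q‖ + σ * (‖Q‖ + G ^ m * ‖u 0‖) := by
          gcongr
          · exact hB Q
          · exact (hu m m.lt_succ_self).trans (by gcongr)
      _ = (G + σ) * ‖Q‖ + σ * G ^ m * ‖u 0‖ := by ring
      _ ≤ (G + σ) * (((G + σ) ^ m - G ^ m) * ‖u 0‖) + σ * G ^ m * ‖u 0‖ := by gcongr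
      _ = ((G + σ) ^ (m + 1) - G ^ (m + 1)) * ‖u 0‖ := by ring

lemma one_add_pow_le_exp (hσ : 0 ≤ σ) (n : ℕ) : (1 + σ) ^ n ≤ Real.exp (n * σ) := by
  rw [Real.exp_nat_mul, add_comm]
  gcongr
  exact Real.add_one_le_exp σ

lemma half_pow_mul_le_norm (hG : 1 ≤ G) (hσ : 0 ≤ σ) (hm : m * σ ≤ 1 / 3)
    (hB : ∀ x, ‖B x‖ ≤ G * ‖x‖) (hu₀ : B (u 0) = G • u 0)
    (hu : ∀ j < m, ‖u (j + 1) - B (u j)‖ ≤ σ * ‖u j‖) : G ^ m * ‖u 0‖ / 2 ≤ ‖u m‖ := by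
  have hG₀ : 0 ≤ G := zero_le_one.trans hG
  have hclose := norm_sub_pow_smul_le hG₀ hσ hB hu₀ hu
  have hratio : (G + σ) ^ m ≤ 3 / 2 * G ^ m := by
    calc (G + σ) ^ m ≤ ((1 + σ) * G) ^ m := by gcongr; nlinarith
      _ = (1 + σ) ^ m * G ^ m := mul_pow _ _ _
      _ ≤ Real.exp (1 / 3) * G ^ m := by
          gcongr
          exact (one_add_pow_le_exp hσ m).trans (Real.exp_le_exp.2 hm)
      _ ≤ 3 / 2 * G ^ m := by
          gcongr
          refine (Real.exp_bound_div_one_sub_of_interval (by norm_num) (by norm_num)).trans ?_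
          norm_num
  have htriangle : G ^ m * ‖u 0‖ ≤ ‖u m‖ + ‖u m - G ^ m • u 0‖ := by
    have := norm_sub_le (u m) (u m - G ^ m • u 0)
    rwa [sub_sub_cancel, norm_smul, Real.norm_of_nonneg (pow_nonneg hG₀ m)] at this
  nlinarith [norm_nonneg (u 0)]

end PowerIteration

/-- Linearizing at `x`, the difference of the two runs follows a power iteration for
`1 - lam ∇²F(x)` whose starting point is an eigenvector for the largest eigenvalue. -/
lemma half_pow_mul_le_norm_iterate_sub {d : ℕ} {F : Eu d → ℝ} {lam ρ ε s : ℝ}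
    (hF : IsSmoothWith F lam) (hH : HessianLipschitzNearCritical F ρ ε s) (hρ : 0 ≤ ρ) {x : Eu d}
    (hx : ‖gradient F x‖ ≤ ε) (hmin : lambdaMin (hessian F x) ≤ 0) {m : ℕ}
    (hm : m * (lam * (ρ * s)) ≤ 1 / 3) {y z : Eu d}
    (hyz : hessian F x (y - z) = lambdaMin (hessian F x) • (y - z))
    (hy : ∀ j ≤ m, (gradStep F lam)^[j] y ∈ Metric.ball x s)
    (hz : ∀ j ≤ m, (gradStep F lam)^[j] z ∈ Metric.ball x s) :
    (1 - lam * lambdaMin (hessian F x)) ^ m * ‖y - z‖ / 2 ≤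
      ‖(gradStep F lam)^[m] y - (gradStep F lam)^[m] z‖ := by
  have hlam := hF.pos
  have hs : 0 < s := Metric.pos_of_mem_ball (hy 0 m.zero_le)
  have hsymm := isSymmetric_hessian ((hH x hx).1 x (Metric.mem_ball_self hs))
  refine half_pow_mul_le_norm (B := ContinuousLinearMap.id ℝ (Eu d) - lam • hessian F x)
    (u := fun j => (gradStep F lam)^[j] y - (gradStep F lam)^[j] z) (by nlinarith)
    (by positivity) hm (norm_sub_smul_apply_le hsymm hlam.le (hF.norm_hessian_apply_le x) hmin)
    ?_ fun j hj => ?_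
  · change y - z - lam • hessian F x (y - z) = _
    rw [hyz, sub_smul, one_smul, smul_smul]
    rfl
  · simp only [Function.iterate_succ_apply']
    have hlin := hH.norm_gradient_sub_sub_le hρ le_rfl hx (hy j hj.le) (hz j hj.le)
    set a := (gradStep F lam)^[j] y
    set b := (gradStep F lam)^[j] z
    have hstep : gradStep F lam a - gradStep F lam b -
        (ContinuousLinearMap.id ℝ (Eu d) - lam • hessian F x) (a - b) =
        -(lam • (gradient F a - gradient F b - hessian F x (a - b))) := by
      change a - lam • gradient F a - (b - lam • gradient F b) -
        ((a - b) - lam • hessian F x (a - b)) = _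
      module
    rw [hstep, norm_neg, norm_smul, Real.norm_of_nonneg hlam.le, mul_assoc]
    gcongr

/-! ### Sets that are thin in one direction -/

section Thin

variable {E : Type*} [NormedAddCommGroup E] [MeasurableSpace E] [BorelSpace E] {W : Set E} {v : E}
  {K : ℕ}

open scoped Pointwise in
lemma natCast_mul_measure_le_of_sub_ne (μ : Measure E) [μ.IsAddLeftInvariant] {B : Set E}
    (hWm : MeasurableSet W) (hW : ∀ x ∈ W, ∀ x' ∈ W, ∀ k : ℕ, 0 < k → x - x' ≠ k • v)
    (hB : ∀ k < K, (k • v) +ᵥ W ⊆ B) : (K : ENNReal) * μ W ≤ μ B := by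
  have hdisj : Pairwise (Function.onFun Disjoint fun k : ℕ => (k • v) +ᵥ W) := by
    refine (pairwise_disjoint_on _).2 fun i j hij => ?_
    rw [Set.disjoint_left]
    rintro _ ⟨x, hx, rfl⟩ ⟨x', hx', hxx'⟩
    refine hW x hx x' hx' (j - i) (Nat.sub_pos_of_lt hij) ?_
    simp only [vadd_eq_add] at hxx'
    rw [sub_nsmul v hij.le, ← sub_eq_add_neg, sub_eq_sub_iff_add_eq_add, add_comm x, hxx', add_comm]
  calc (K : ENNReal) * μ W = ∑ k ∈ Finset.range K, μ ((k • v) +ᵥ W) := by simp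
    _ = μ (⋃ k ∈ Finset.range K, (k • v) +ᵥ W) :=
        (measure_biUnion_finset (fun i _ j _ hij => hdisj hij)
          fun k _ => hWm.const_vadd (k • v)).symm
    _ ≤ μ B := measure_mono (Set.iUnion₂_subset fun k hk => hB k (Finset.mem_range.1 hk))

variable [NormedSpace ℝ E] [FiniteDimensional ℝ E] (μ : Measure E) [μ.IsAddHaarMeasure] {r : ℝ}

lemma addHaar_closedBall_add_le_three_mul (hr : 0 < r) {t : ℝ} (ht : 0 ≤ t)
    (htr : finrank ℝ E * t ≤ r) :
    μ (Metric.closedBall 0 (r + t)) ≤ 3 * μ (Metric.closedBall 0 r) := by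
  have hpow : (r + t) ^ finrank ℝ E ≤ 3 * r ^ finrank ℝ E := by
    calc (r + t) ^ finrank ℝ E = (1 + t / r) ^ finrank ℝ E * r ^ finrank ℝ E := by
          rw [← mul_pow]
          congr 1
          field_simp
      _ ≤ Real.exp 1 * r ^ finrank ℝ E := by
          gcongr
          refine (one_add_pow_le_exp (div_nonneg ht hr.le) _).trans (Real.exp_le_exp.2 ?_)
          rwa [← mul_div_assoc, div_le_one hr]
      _ ≤ 3 * r ^ finrank ℝ E := by
          gcongr
          exact Real.exp_one_lt_three.le
  rw [Measure.addHaar_closedBall _ _ (by positivity), Measure.addHaar_closedBall _ _ hr.le,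
    ← mul_assoc]
  gcongr
  exact (ENNReal.ofReal_le_ofReal hpow).trans_eq
    (by rw [ENNReal.ofReal_mul (by norm_num), ENNReal.ofReal_ofNat])

lemma natCast_mul_addHaar_le_of_sub_ne (hr : 0 < r) (hWm : MeasurableSet W)
    (hWr : W ⊆ Metric.closedBall 0 r)
    (hW : ∀ x ∈ W, ∀ x' ∈ W, ∀ k : ℕ, 0 < k → x - x' ≠ k • v)
    (hK : finrank ℝ E * (K * ‖v‖) ≤ r) :
    (K : ENNReal) * μ W ≤ 3 * μ (Metric.closedBall 0 r) := by
  refine (natCast_mul_measure_le_of_sub_ne μ hWm hW fun k hk => ?_).trans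
    (addHaar_closedBall_add_le_three_mul μ hr (by positivity) hK)
  rintro _ ⟨x, hx, rfl⟩
  rw [mem_closedBall_zero_iff, add_comm r]
  refine (norm_add_le _ _).trans (add_le_add ?_ (mem_closedBall_zero_iff.1 (hWr hx)))
  exact (norm_nsmul_le).trans (by gcongr)

end Thin

/-! ### The parameters -/

/-- The standing assumptions on the parameters. The lower bound on `ι` is far from optimal. -/
structure Admissible (lam ρ ε ι : ℝ) : Prop where
  lam_pos : 0 < lam
  rho_pos : 0 < ρ
  eps_pos : 0 < ε
  eps_lt : ε < 1 / (lam ^ 2 * ρ)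
  le_iota : 1000 ≤ ι

/-- The number of rounds from one perturbation to the earliest possible next one. -/
def windowLength (lam ρ ε ι : ℝ) : ℕ := ⌊pertInterval lam ρ ε ι⌋₊ + 1

/-- The decrease of the potential that is charged to each bad round: a large gradient decreases it
by more, and an escape from a saddle point by more than this for each round of its window. -/
def roundDecrease (lam ε ι : ℝ) : ℝ := lam * ε ^ 2 / (101 * ι ^ 4)

/-- If two perturbations of a saddle point differ by at least this length in the direction of most
negative curvature, then one of them escapes. -/
def separation (lam ρ ε ι : ℝ) : ℝ := 4 * locRadius ρ ε ι / (lam * Real.exp (ι / 4))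

lemma windowLength_pos (lam ρ ε ι : ℝ) : 0 < windowLength lam ρ ε ι := Nat.succ_pos _

lemma pertInterval_lt_windowLength (lam ρ ε ι : ℝ) :
    pertInterval lam ρ ε ι < windowLength lam ρ ε ι := by
  exact_mod_cast Nat.lt_floor_add_one (pertInterval lam ρ ε ι)

lemma pertInterval_eq (lam ρ ε ι : ℝ) : pertInterval lam ρ ε ι = ι / (lam * √(ρ * ε)) := by
  rw [pertInterval, one_div_mul_eq_div]

section

variable {lam ρ ε ι Δ : ℝ}

lemma sqrt_mul_sqrt_div (hρ : 0 < ρ) (hε : 0 ≤ ε) : √(ρ * ε) * √(ε / ρ) = ε := by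
  rw [← Real.sqrt_mul (by positivity), show ρ * ε * (ε / ρ) = ε ^ 2 by field_simp,
    Real.sqrt_sq hε]

lemma locRadius_eq (hρ : 0 < ρ) (hε : 0 < ε) : locRadius ρ ε ι = ε / (4 * ι * √(ρ * ε)) := by
  have hq : 0 < √(ρ * ε) := Real.sqrt_pos.2 (mul_pos hρ hε)
  rw [locRadius, eq_div_of_mul_eq hq.ne' ((mul_comm _ _).trans (sqrt_mul_sqrt_div hρ hε.le))]
  ring

lemma decrease_eq (hρ : 0 < ρ) (hε : 0 < ε) :
    decrease ρ ε ι = ε ^ 2 / (50 * ι ^ 3 * √(ρ * ε)) := by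
  have hq : 0 < √(ρ * ε) := Real.sqrt_pos.2 (mul_pos hρ hε)
  have hsqrt : √(ε ^ 3 / ρ) = ε ^ 2 / √(ρ * ε) := by
    rw [eq_div_iff hq.ne', show ε ^ 3 / ρ = ε ^ 2 * (ε / ρ) by ring,
      Real.sqrt_mul (by positivity), Real.sqrt_sq hε.le, mul_assoc, mul_comm √(ε / ρ),
      sqrt_mul_sqrt_div hρ hε.le, sq]
  rw [decrease, hsqrt]
  ring

lemma numIter_eq_of_one_le (hlam : 0 < lam) (hρ : 0 < ρ) (hε : 0 < ε) (hι : 1 ≤ ι) (hΔ : 0 ≤ Δ) :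
    numIter lam ρ ε ι Δ = 400 * ι ^ 4 * (Δ / (lam * ε ^ 2)) := by
  have hq : 0 < √(ρ * ε) := Real.sqrt_pos.2 (mul_pos hρ hε)
  have hescape : Δ / (decrease ρ ε ι / (2 * pertInterval lam ρ ε ι)) =
      100 * ι ^ 4 * (Δ / (lam * ε ^ 2)) := by
    rw [decrease_eq hρ hε, pertInterval_eq]
    generalize √(ρ * ε) = q at hq
    field_simp
    ring
  have hgrad : Δ / (lam * ε ^ 2 / 2) = 2 * (Δ / (lam * ε ^ 2)) := by field_simp
  have hle : 2 * (Δ / (lam * ε ^ 2)) ≤ 100 * ι ^ 4 * (Δ / (lam * ε ^ 2)) := by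
    gcongr
    linarith [one_le_pow₀ (n := 4) hι]
  rw [numIter, hescape, hgrad, max_eq_left hle]
  ring

lemma pow_nine_le_exp (hι : (10 : ℝ) ^ 30 ≤ ι) : 54000000 * ι ^ 9 ≤ Real.exp (ι / 8) := by
  calc 54000000 * ι ^ 9 = ι ^ 9 * (54000000 * (8 ^ 10 * Nat.factorial 10)) /
        (8 ^ 10 * Nat.factorial 10) := by
        rw [← mul_assoc, mul_div_cancel_right₀ _ (by positivity), mul_comm]
    _ ≤ ι ^ 9 * ι / (8 ^ 10 * Nat.factorial 10) := by
        gcongr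
        exact le_trans (by norm_num [Nat.factorial]) hι
    _ = (ι / 8) ^ 10 / Nat.factorial 10 := by rw [div_pow, div_div, pow_succ ι 9]
    _ ≤ Real.exp (ι / 8) := Real.pow_div_factorial_le_exp (ι / 8) (by positivity) 10

lemma sq_le_exp {X : ℝ} (hX : 0 < X) (hι : 16 * Real.log X ≤ ι) : X ^ 2 ≤ Real.exp (ι / 8) := by
  rw [← Real.log_le_iff_le_exp (by positivity), Real.log_pow]
  push_cast
  linarith

end

namespace Admissible

variable {lam ρ ε ι Δ : ℝ} (h : Admissible lam ρ ε ι)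

include h

lemma iota_pos : 0 < ι := lt_of_lt_of_le (by norm_num) h.le_iota

lemma one_le_iota_pow (n : ℕ) : 1 ≤ ι ^ n := one_le_pow₀ (by linarith [h.le_iota])

lemma sqrt_pos : 0 < √(ρ * ε) := Real.sqrt_pos.2 (mul_pos h.rho_pos h.eps_pos)

lemma lam_mul_sqrt_pos : 0 < lam * √(ρ * ε) := mul_pos h.lam_pos h.sqrt_pos

lemma lam_mul_sqrt_lt_one : lam * √(ρ * ε) < 1 := by
  have hlam := h.lam_pos
  have hρ := h.rho_pos
  have heps := h.eps_lt
  rw [lt_div_iff₀ (by positivity)] at heps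
  rw [← sq_lt_one_iff₀ h.lam_mul_sqrt_pos.le, mul_pow,
    Real.sq_sqrt (mul_pos hρ h.eps_pos).le]
  linarith

lemma locRadius_pos : 0 < locRadius ρ ε ι := by
  have := h.sqrt_pos
  have := h.iota_pos
  have := h.eps_pos
  rw [locRadius_eq h.rho_pos h.eps_pos]
  positivity

lemma decrease_pos : 0 < decrease ρ ε ι := by
  have := h.sqrt_pos
  have := h.iota_pos
  have := h.eps_pos
  rw [decrease_eq h.rho_pos h.eps_pos]
  positivity

lemma pertRadius_pos : 0 < pertRadius ε ι := by
  have := h.iota_pos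
  have := h.eps_pos
  unfold pertRadius
  positivity

lemma roundDecrease_pos : 0 < roundDecrease lam ε ι := by
  have := h.iota_pos
  have := h.eps_pos
  have := h.lam_pos
  unfold roundDecrease
  positivity

lemma rho_mul_locRadius : ρ * locRadius ρ ε ι = √(ρ * ε) / (4 * ι) := by
  have hq := h.sqrt_pos
  have hι := h.iota_pos
  rw [locRadius_eq h.rho_pos h.eps_pos]
  field_simp
  exact (Real.sq_sqrt (mul_pos h.rho_pos h.eps_pos).le).symm

lemma decrease_eq_locRadius : decrease ρ ε ι = 8 / 25 * (√(ρ * ε) * locRadius ρ ε ι ^ 2 / ι) := by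
  have hq := h.sqrt_pos
  have hι := h.iota_pos
  rw [decrease_eq h.rho_pos h.eps_pos, locRadius_eq h.rho_pos h.eps_pos]
  generalize √(ρ * ε) = q at hq
  field_simp
  ring

lemma pertRadius_eq_locRadius :
    pertRadius ε ι = √(ρ * ε) * locRadius ρ ε ι / (100 * ι ^ 2) := by
  have hq := h.sqrt_pos
  have hι := h.iota_pos
  rw [locRadius_eq h.rho_pos h.eps_pos, pertRadius]
  generalize √(ρ * ε) = q at hq
  field_simp
  ring

lemma pertRadius_le : pertRadius ε ι ≤ ε / 400 := by
  have hε := h.eps_pos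
  unfold pertRadius
  gcongr
  linarith [h.one_le_iota_pow 3]

lemma lam_mul_pertRadius_le : lam * pertRadius ε ι ≤ locRadius ρ ε ι / 100 := by
  have hR := h.locRadius_pos
  calc lam * pertRadius ε ι = lam * √(ρ * ε) * locRadius ρ ε ι / (100 * ι ^ 2) := by
        rw [h.pertRadius_eq_locRadius]
        ring
    _ ≤ 1 * locRadius ρ ε ι / (100 * 1) := by
        gcongr
        exacts [h.lam_mul_sqrt_lt_one.le, h.one_le_iota_pow 2]
    _ = locRadius ρ ε ι / 100 := by ring

lemma lam_mul_pertRadius_increase_le :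
    lam * (ε * pertRadius ε ι + pertRadius ε ι ^ 2 / 2) ≤ 13 / 100 * decrease ρ ε ι := by
  have hlam := h.lam_pos
  have hr := h.pertRadius_pos
  have hquad : pertRadius ε ι ^ 2 ≤ ε / 400 * pertRadius ε ι := by
    rw [sq]
    gcongr
    exact h.pertRadius_le
  have hlin : lam * (ε * pertRadius ε ι) = lam * √(ρ * ε) * (decrease ρ ε ι / 8) := by
    have hq := h.sqrt_pos
    have hι := h.iota_pos
    rw [decrease_eq h.rho_pos h.eps_pos, pertRadius]
    generalize √(ρ * ε) = q at hq
    field_simp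
    ring
  nlinarith [h.lam_mul_sqrt_lt_one, h.decrease_pos]

lemma le_pertInterval : 1000 ≤ pertInterval lam ρ ε ι := by
  rw [pertInterval_eq, le_div_iff₀ h.lam_mul_sqrt_pos]
  nlinarith [h.le_iota, h.lam_mul_sqrt_lt_one]

lemma pertInterval_nonneg : 0 ≤ pertInterval lam ρ ε ι :=
  le_trans (by norm_num) h.le_pertInterval

lemma windowLength_le : (windowLength lam ρ ε ι : ℝ) ≤ 1001 / 1000 * pertInterval lam ρ ε ι := by
  have hτ := h.le_pertInterval
  have hfloor := Nat.floor_le h.pertInterval_nonneg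
  rw [windowLength, Nat.cast_succ]
  linarith

lemma windowLength_mul_le :
    windowLength lam ρ ε ι * (lam * √(ρ * ε)) ≤ 1001 / 1000 * ι := by
  have hm := h.windowLength_le
  rwa [pertInterval_eq, ← mul_div_assoc, le_div_iff₀ h.lam_mul_sqrt_pos] at hm

lemma iota_lt_windowLength_mul : ι < windowLength lam ρ ε ι * (lam * √(ρ * ε)) := by
  have hm := pertInterval_lt_windowLength lam ρ ε ι
  rwa [pertInterval_eq, div_lt_iff₀ h.lam_mul_sqrt_pos] at hm

lemma windowLength_mul_rho_mul_locRadius_le :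
    windowLength lam ρ ε ι * (lam * (ρ * locRadius ρ ε ι)) ≤ 1 / 3 := by
  have hι := h.iota_pos
  rw [h.rho_mul_locRadius, ← mul_div_assoc, ← mul_div_assoc, div_le_iff₀ (by positivity)]
  linarith [h.windowLength_mul_le]

lemma roundDecrease_le : roundDecrease lam ε ι ≤ 49 / 100 * (lam * ε ^ 2) := by
  have hlam := h.lam_pos
  have hι := h.iota_pos
  rw [roundDecrease, div_le_iff₀ (by positivity)]
  nlinarith [h.one_le_iota_pow 4, mul_nonneg hlam.le (sq_nonneg ε)]

lemma roundDecrease_mul_windowLength_le :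
    roundDecrease lam ε ι * windowLength lam ρ ε ι ≤ decrease ρ ε ι / 2 := by
  have hq := h.sqrt_pos
  have hι := h.iota_pos
  have hε := h.eps_pos
  calc roundDecrease lam ε ι * windowLength lam ρ ε ι
      = ε ^ 2 / (101 * ι ^ 4 * √(ρ * ε)) * (windowLength lam ρ ε ι * (lam * √(ρ * ε))) := by
        rw [roundDecrease]
        generalize √(ρ * ε) = q at hq
        field_simp
    _ ≤ ε ^ 2 / (101 * ι ^ 4 * √(ρ * ε)) * (101 / 100 * ι) := by
        refine mul_le_mul_of_nonneg_left ?_ (by positivity)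
        linarith [h.windowLength_mul_le]
    _ = decrease ρ ε ι / 2 := by
        rw [decrease_eq h.rho_pos h.eps_pos]
        field_simp
        norm_num

lemma numIter_eq (hΔ : 0 ≤ Δ) : numIter lam ρ ε ι Δ = 400 * ι ^ 4 * (Δ / (lam * ε ^ 2)) :=
  numIter_eq_of_one_le h.lam_pos h.rho_pos h.eps_pos (by linarith [h.le_iota]) hΔ

lemma numIter_nonneg (hΔ : 0 ≤ Δ) : 0 ≤ numIter lam ρ ε ι Δ := by
  have hlam := h.lam_pos
  rw [h.numIter_eq hΔ]
  positivity

lemma roundDecrease_mul_numIter (hΔ : 0 ≤ Δ) :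
    roundDecrease lam ε ι * (10201 / 40000 * numIter lam ρ ε ι Δ) = Δ + Δ / 100 := by
  have hlam := h.lam_pos
  have hι := h.iota_pos
  have hε := h.eps_pos
  rw [h.numIter_eq hΔ, roundDecrease]
  field_simp
  ring

lemma pertRadius_sq_mul_numIter_le (hΔ : 0 ≤ Δ) :
    2 * lam * pertRadius ε ι ^ 2 / windowLength lam ρ ε ι * numIter lam ρ ε ι Δ ≤ Δ / 100 := by
  have hlam := h.lam_pos
  have hι := h.iota_pos
  have hε := h.eps_pos
  have hm : (1 : ℝ) ≤ windowLength lam ρ ε ι := by exact_mod_cast windowLength_pos lam ρ ε ι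
  calc 2 * lam * pertRadius ε ι ^ 2 / windowLength lam ρ ε ι * numIter lam ρ ε ι Δ
      = Δ / (200 * (ι ^ 2 * windowLength lam ρ ε ι)) := by
        rw [h.numIter_eq hΔ, pertRadius]
        field_simp
        ring
    _ ≤ Δ / 100 := by
        gcongr
        nlinarith [h.one_le_iota_pow 2]

lemma windowLength_le_numIter (hΔ : decrease ρ ε ι ≤ Δ) :
    8 * (windowLength lam ρ ε ι : ℝ) ≤ 1001 / 1000 * numIter lam ρ ε ι Δ := by
  have hτ := h.le_pertInterval
  have hdec := h.decrease_pos
  have hmax : 2 * pertInterval lam ρ ε ι ≤ Δ / (decrease ρ ε ι / (2 * pertInterval lam ρ ε ι)) := by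
    rw [div_div_eq_mul_div, le_div_iff₀ hdec, mul_comm]
    gcongr
  have hT : 4 * (2 * pertInterval lam ρ ε ι) ≤ numIter lam ρ ε ι Δ :=
    mul_le_mul_of_nonneg_left (hmax.trans (le_max_left _ _)) (by norm_num)
  linarith [h.windowLength_le]

section UnionBound

variable {d N : ℕ} {δ : ℝ} (hΔ : decrease ρ ε ι ≤ Δ)

include hΔ

lemma one_le_of_decrease_le : 1 ≤ 50 * ι ^ 3 * (lam * √(ρ * ε)) * (Δ / (lam * ε ^ 2)) := by
  have hq := h.sqrt_pos
  have hι := h.iota_pos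
  have hε := h.eps_pos
  have hlam := h.lam_pos
  calc (1 : ℝ) = 50 * ι ^ 3 * (lam * √(ρ * ε)) * (decrease ρ ε ι / (lam * ε ^ 2)) := by
        rw [decrease_eq h.rho_pos h.eps_pos]
        field_simp
    _ ≤ 50 * ι ^ 3 * (lam * √(ρ * ε)) * (Δ / (lam * ε ^ 2)) := by gcongr

lemma numIter_add_one_le : numIter lam ρ ε ι Δ + 1 ≤ 450 * ι ^ 4 * (Δ / (lam * ε ^ 2)) := by
  have hΔ₀ : 0 ≤ Δ := h.decrease_pos.le.trans hΔ
  have hι := h.iota_pos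
  have hlam := h.lam_pos
  have hone := h.one_le_of_decrease_le hΔ
  have hu : 50 * ι ^ 3 * (lam * √(ρ * ε)) * (Δ / (lam * ε ^ 2)) ≤
      50 * ι ^ 3 * ι * (Δ / (lam * ε ^ 2)) := by
    gcongr
    linarith [h.lam_mul_sqrt_lt_one, h.le_iota]
  rw [h.numIter_eq hΔ₀]
  linarith

variable (hd : 0 < d) (hδ₀ : 0 < δ) (hδ₁ : δ ≤ 1)
  (hι : (10 : ℝ) ^ 30 * max 1 (Real.log (d * Δ / (lam * ε ^ 2 * δ))) ≤ ι)
  (hN : (N : ℝ) ≤ numIter lam ρ ε ι Δ + 1)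

include hd hδ₀ hδ₁ hι hN

lemma natCast_mul_le_exp :
    2400 * ι ^ 2 * (N * d) ≤ δ * (lam * √(ρ * ε)) * Real.exp (ι / 4) := by
  have hu := h.lam_mul_sqrt_pos
  have hι₀ := h.iota_pos
  have hε := h.eps_pos
  have hlam := h.lam_pos
  have hΔ₀ : 0 < Δ := h.decrease_pos.trans_le hΔ
  have hd₁ : (1 : ℝ) ≤ d := by exact_mod_cast hd
  have hι₁ : (10 : ℝ) ^ 30 ≤ ι := by linarith [le_max_left 1 (Real.log (d * Δ / (lam * ε ^ 2 * δ)))]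
  have hlog : 16 * Real.log (d * Δ / (lam * ε ^ 2 * δ)) ≤ ι := by
    have := le_max_left 1 (Real.log (d * Δ / (lam * ε ^ 2 * δ)))
    linarith [le_max_right 1 (Real.log (d * Δ / (lam * ε ^ 2 * δ)))]
  have hN' := hN.trans (h.numIter_add_one_le hΔ)
  have hone := h.one_le_of_decrease_le hΔ
  have hXδ : d * (Δ / (lam * ε ^ 2)) = d * Δ / (lam * ε ^ 2 * δ) * δ := by field_simp
  set D := Δ / (lam * ε ^ 2)
  set X := d * Δ / (lam * ε ^ 2 * δ)
  have hD : 0 < D := by positivity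
  have hX : 0 < X := by positivity
  have hDX : D ≤ X := by nlinarith
  have hexp : 54000000 * ι ^ 9 * X ^ 2 ≤ Real.exp (ι / 4) := by
    rw [show ι / 4 = ι / 8 + ι / 8 by ring, Real.exp_add]
    exact mul_le_mul (pow_nine_le_exp hι₁) (sq_le_exp hX hlog) (by positivity) (by positivity)
  calc 2400 * ι ^ 2 * (N * d) ≤ 2400 * ι ^ 2 * (450 * ι ^ 4 * D * d) := by gcongr
    _ = 1080000 * ι ^ 6 * X * δ * 1 := by rw [mul_assoc _ D, mul_comm D, hXδ]; ring
    _ ≤ 1080000 * ι ^ 6 * X * δ * (50 * ι ^ 3 * (lam * √(ρ * ε)) * X) := by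
        gcongr
        exact hone.trans (by gcongr)
    _ = δ * (lam * √(ρ * ε)) * (54000000 * ι ^ 9 * X ^ 2) := by ring
    _ ≤ δ * (lam * √(ρ * ε)) * Real.exp (ι / 4) := by gcongr

lemma natCast_mul_separation_le :
    d * (6 * N / δ * separation lam ρ ε ι) ≤ pertRadius ε ι := by
  have hR := h.locRadius_pos
  have hι₀ := h.iota_pos
  have hlam := h.lam_pos
  have hq := h.sqrt_pos
  calc d * (6 * N / δ * separation lam ρ ε ι)
      = 2400 * ι ^ 2 * (N * d) *
          (√(ρ * ε) * locRadius ρ ε ι /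
            (100 * ι ^ 2 * (δ * (lam * √(ρ * ε)) * Real.exp (ι / 4)))) := by
        rw [separation]
        generalize √(ρ * ε) = q at hq
        field_simp
        ring
    _ ≤ δ * (lam * √(ρ * ε)) * Real.exp (ι / 4) *
          (√(ρ * ε) * locRadius ρ ε ι /
            (100 * ι ^ 2 * (δ * (lam * √(ρ * ε)) * Real.exp (ι / 4)))) := by
        refine mul_le_mul_of_nonneg_right ?_ (by positivity)
        exact h.natCast_mul_le_exp hΔ hd hδ₀ hδ₁ hι hN
    _ = pertRadius ε ι := by
        rw [h.pertRadius_eq_locRadius]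
        generalize √(ρ * ε) = q at hq
        field_simp

end UnionBound

end Admissible

/-! ### Escape from saddle points -/

/-- The perturbations of `x` after which a window of gradient descent fails to decrease `F` by half
of the function decrease. -/
def stuck {d : ℕ} (F : Eu d → ℝ) (lam ρ ε ι : ℝ) (x : Eu d) : Set (Eu d) :=
  {v | F x - decrease ρ ε ι / 2 < F ((gradStep F lam)^[windowLength lam ρ ε ι] (x - lam • v))}

section Escape

variable {d : ℕ} {F : Eu d → ℝ} {lam ρ ε ι : ℝ} {x v : Eu d}

lemma isOpen_stuck (hF : IsSmoothWith F lam) :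
    IsOpen {p : Eu d × Eu d | p.2 ∈ stuck F lam ρ ε ι p.1} := by
  have hcont : Continuous F := hF.differentiable.continuous
  have hiter := hF.continuous_gradStep.iterate (windowLength lam ρ ε ι)
  exact isOpen_lt (by fun_prop) (hcont.comp (hiter.comp (by fun_prop)))

lemma measurableSet_stuck (hF : IsSmoothWith F lam) (x : Eu d) :
    MeasurableSet (stuck F lam ρ ε ι x) :=
  ((isOpen_stuck hF).preimage (Continuous.prodMk_right x)).measurableSet

lemma norm_iterate_sub_le_of_le_apply (h : Admissible lam ρ ε ι) (hF : IsSmoothWith F lam)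
    {y : Eu d} {j : ℕ} (hj : j ≤ windowLength lam ρ ε ι)
    (hdec : F y - F ((gradStep F lam)^[j] y) ≤ 63 / 100 * decrease ρ ε ι) :
    ‖(gradStep F lam)^[j] y - y‖ ≤ 2 / 3 * locRadius ρ ε ι := by
  have hlam := h.lam_pos
  have hι := h.iota_pos
  have hR := h.locRadius_pos
  refine (sq_le_sq₀ (norm_nonneg _) (by positivity)).1 ?_
  have hjm : (j : ℝ) ≤ windowLength lam ρ ε ι := by exact_mod_cast hj
  have hdescent : F ((gradStep F lam)^[j] y) ≤ F y := hF.antitone_apply_iterate y j.zero_le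
  rw [← sub_nonneg] at hdescent
  calc ‖(gradStep F lam)^[j] y - y‖ ^ 2
      ≤ j * (2 * lam * (F y - F ((gradStep F lam)^[j] y))) := hF.norm_iterate_sub_sq_le y j
    _ ≤ windowLength lam ρ ε ι * (2 * lam * (63 / 100 * decrease ρ ε ι)) := by gcongr
    _ = windowLength lam ρ ε ι * (lam * √(ρ * ε)) *
        (63 / 50 * (8 / 25 * (locRadius ρ ε ι ^ 2 / ι))) := by
      rw [h.decrease_eq_locRadius]; ring
    _ ≤ 1001 / 1000 * ι * (63 / 50 * (8 / 25 * (locRadius ρ ε ι ^ 2 / ι))) :=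
      mul_le_mul_of_nonneg_right h.windowLength_mul_le (by positivity)
    _ = 63063 / 156250 * locRadius ρ ε ι ^ 2 := by field_simp; ring
    _ ≤ (2 / 3 * locRadius ρ ε ι) ^ 2 := by nlinarith [sq_nonneg (locRadius ρ ε ι)]

lemma iterate_mem_ball_of_mem_stuck (h : Admissible lam ρ ε ι) (hF : IsSmoothWith F lam)
    (hx : ‖gradient F x‖ ≤ ε) (hv : ‖v‖ ≤ pertRadius ε ι) (hstuck : v ∈ stuck F lam ρ ε ι x)
    {j : ℕ} (hj : j ≤ windowLength lam ρ ε ι) :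
    (gradStep F lam)^[j] (x - lam • v) ∈ Metric.ball x (locRadius ρ ε ι) := by
  set y := x - lam • v with hy
  have hlate : F x - decrease ρ ε ι / 2 < F ((gradStep F lam)^[j] y) :=
    (show _ < _ from hstuck).trans_le (hF.antitone_apply_iterate y hj)
  have hpert : F y ≤ F x + 13 / 100 * decrease ρ ε ι :=
    (hF.apply_sub_smul_le hx hv).trans (by linarith [h.lam_mul_pertRadius_increase_le])
  have htravel := norm_iterate_sub_le_of_le_apply h hF (y := y) hj (by linarith)
  have hmove : ‖y - x‖ ≤ locRadius ρ ε ι / 100 := by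
    rw [hy, sub_sub_cancel_left, norm_neg, norm_smul, Real.norm_of_nonneg h.lam_pos.le]
    exact (mul_le_mul_of_nonneg_left hv h.lam_pos.le).trans h.lam_mul_pertRadius_le
  rw [mem_ball_iff_norm]
  linarith [norm_sub_le_norm_sub_add_norm_sub ((gradStep F lam)^[j] y) y x, h.locRadius_pos]

lemma exists_le_sub_decrease (hd : 0 < d) (h : Admissible lam ρ ε ι) (hF : IsSmoothWith F lam)
    (hH : HessianLipschitzNearCritical F ρ ε (locRadius ρ ε ι))
    (hx : ‖gradient F x‖ ≤ ε) (hmin : lambdaMin (hessian F x) ≤ -(√(ρ * ε) / 2)) :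
    ∃ y, F y ≤ F x - 2 * decrease ρ ε ι := by
  have hq := h.sqrt_pos
  have hR := h.locRadius_pos
  have hι := h.le_iota
  obtain ⟨y, hy⟩ := hH.exists_le hd hF.differentiable h.rho_pos.le (half_pos hR)
    (half_lt_self hR) hx
  have hcurv : lambdaMin (hessian F x) + ρ * locRadius ρ ε ι ≤ -(499 / 1000 * √(ρ * ε)) := by
    have hsmall : √(ρ * ε) / (4 * ι) ≤ √(ρ * ε) / 1000 := by gcongr; linarith
    rw [h.rho_mul_locRadius]
    linarith
  have hD : decrease ρ ε ι ≤ 8 / 25 * (√(ρ * ε) * locRadius ρ ε ι ^ 2 / 1000) := by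
    rw [h.decrease_eq_locRadius]
    gcongr
  refine ⟨y, hy.trans ?_⟩
  calc F x + (lambdaMin (hessian F x) + ρ * locRadius ρ ε ι) * (locRadius ρ ε ι / 2) ^ 2 / 2
      ≤ F x + -(499 / 1000 * √(ρ * ε)) * (locRadius ρ ε ι / 2) ^ 2 / 2 := by gcongr
    _ ≤ F x - 2 * decrease ρ ε ι := by nlinarith [mul_pos hq (pow_pos hR 2)]

lemma exp_le_pow_windowLength (h : Admissible lam ρ ε ι) {γ : ℝ} (hγ : γ ≤ -(√(ρ * ε) / 2)) :
    Real.exp (ι / 4) ≤ (1 - lam * γ) ^ windowLength lam ρ ε ι := by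
  set u := lam * √(ρ * ε) with hu
  have hu₀ : 0 < u := h.lam_mul_sqrt_pos
  have hu₁ : u < 1 := h.lam_mul_sqrt_lt_one
  have hexp : Real.exp (u / 4) ≤ 1 + u / 2 := by
    have habs := Real.abs_exp_sub_one_le (x := u / 4) (by rw [abs_of_pos] <;> linarith)
    rw [abs_of_pos (by linarith : 0 < u / 4)] at habs
    linarith [le_abs_self (Real.exp (u / 4) - 1)]
  have hgrowth : 1 + u / 2 ≤ 1 - lam * γ := by rw [hu]; nlinarith [h.lam_pos]
  have hwindow : ι < windowLength lam ρ ε ι * u := h.iota_lt_windowLength_mul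
  calc Real.exp (ι / 4) ≤ Real.exp (windowLength lam ρ ε ι * (u / 4)) :=
        Real.exp_le_exp.2 (by linarith)
    _ = Real.exp (u / 4) ^ windowLength lam ρ ε ι := Real.exp_nat_mul _ _
    _ ≤ _ := by gcongr; exact hexp.trans hgrowth

lemma sub_ne_smul_of_mem_stuck (h : Admissible lam ρ ε ι) (hF : IsSmoothWith F lam)
    (hH : HessianLipschitzNearCritical F ρ ε (locRadius ρ ε ι))
    (hx : ‖gradient F x‖ ≤ ε) (hmin : lambdaMin (hessian F x) ≤ -(√(ρ * ε) / 2))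
    {e : Eu d} (he : ‖e‖ = 1) (hAe : hessian F x e = lambdaMin (hessian F x) • e)
    {v' : Eu d} (hv : v ∈ stuck F lam ρ ε ι x) (hv' : v' ∈ stuck F lam ρ ε ι x)
    (hvr : ‖v‖ ≤ pertRadius ε ι) (hvr' : ‖v'‖ ≤ pertRadius ε ι) {t : ℝ}
    (ht : separation lam ρ ε ι ≤ t) : v - v' ≠ t • e := by
  intro hvv
  have hlam := h.lam_pos
  have hR := h.locRadius_pos
  have ht₀ : 0 < t := lt_of_lt_of_le (by rw [separation]; positivity) ht
  have hmem := fun j (hj : j ≤ windowLength lam ρ ε ι) =>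
    iterate_mem_ball_of_mem_stuck h hF hx hvr hv hj
  have hmem' := fun j (hj : j ≤ windowLength lam ρ ε ι) =>
    iterate_mem_ball_of_mem_stuck h hF hx hvr' hv' hj
  have hdiff : (x - lam • v) - (x - lam • v') = (-(lam * t)) • e := by
    rw [sub_sub_sub_cancel_left, ← smul_sub, ← neg_sub v, hvv]
    module
  have hapart := half_pow_mul_le_norm_iterate_sub hF hH h.rho_pos.le hx
    (by linarith [h.sqrt_pos]) h.windowLength_mul_rho_mul_locRadius_le
    (by rw [hdiff, map_smul, hAe, smul_comm]) hmem hmem'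
  rw [hdiff, norm_smul, he, mul_one, norm_neg, Real.norm_of_nonneg (by positivity)] at hapart
  have hclose := (dist_triangle_right _ _ x).trans_lt
    (add_lt_add (hmem _ le_rfl) (hmem' _ le_rfl))
  rw [dist_eq_norm] at hclose
  have hgrowth := mul_le_mul_of_nonneg_right (exp_le_pow_windowLength h hmin)
    (mul_pos hlam ht₀).le
  rw [separation, div_le_iff₀ (by positivity)] at ht
  linarith

lemma volume_stuck_le (hd : 0 < d) (h : Admissible lam ρ ε ι) (hF : IsSmoothWith F lam)
    (hH : HessianLipschitzNearCritical F ρ ε (locRadius ρ ε ι))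
    (hx : ‖gradient F x‖ ≤ ε) (hmin : lambdaMin (hessian F x) ≤ -(√(ρ * ε) / 2))
    {p : ℝ} (hp₀ : 0 < p) (hp₁ : p ≤ 1)
    (hsep : d * (6 / p * separation lam ρ ε ι) ≤ pertRadius ε ι) :
    volume (stuck F lam ρ ε ι x ∩ Metric.closedBall 0 (pertRadius ε ι)) ≤
      ENNReal.ofReal p * volume (Metric.closedBall (0 : Eu d) (pertRadius ε ι)) := by
  have hlam := h.lam_pos
  have hR := h.locRadius_pos
  have hw : 0 < separation lam ρ ε ι := by rw [separation]; positivity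
  obtain ⟨e, he, hAe⟩ := exists_lambdaMin_eigenvector hd
    (isSymmetric_hessian ((hH x hx).1 x (Metric.mem_ball_self hR)))
  set K := ⌈3 / p⌉₊
  have hK_ge : 3 / p ≤ K := Nat.le_ceil _
  have hK_le : (K : ℝ) ≤ 6 / p := by
    have hone : 1 ≤ 3 / p := by rw [le_div_iff₀ hp₀]; linarith
    have hsum : 3 / p + 3 / p = 6 / p := by ring
    linarith [Nat.ceil_lt_add_one (by positivity : 0 ≤ 3 / p)]
  have hK₀ : 0 < (K : ℝ) := (by positivity : 0 < 3 / p).trans_le hK_ge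
  have hthin := natCast_mul_addHaar_le_of_sub_ne volume h.pertRadius_pos (K := K)
    (v := separation lam ρ ε ι • e)
    ((measurableSet_stuck hF x).inter measurableSet_closedBall) Set.inter_subset_right
    (fun v hv v' hv' k hk => by
      have hk' : (1 : ℝ) ≤ k := by exact_mod_cast hk
      rw [← Nat.cast_smul_eq_nsmul ℝ, smul_smul]
      exact sub_ne_smul_of_mem_stuck h hF hH hx hmin he hAe hv.1 hv'.1
        (mem_closedBall_zero_iff.1 hv.2) (mem_closedBall_zero_iff.1 hv'.2)
        (le_mul_of_one_le_left hw.le hk'))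
    (by
      rw [finrank_euclideanSpace_fin, norm_smul, he, mul_one, Real.norm_of_nonneg hw.le]
      exact le_trans (by gcongr) hsep)
  have hpK : 3 ≤ ENNReal.ofReal p * K := by
    rw [← ENNReal.ofReal_natCast, ← ENNReal.ofReal_mul hp₀.le, ← ENNReal.ofReal_ofNat]
    exact ENNReal.ofReal_le_ofReal (by rwa [div_le_iff₀' hp₀] at hK_ge)
  refine (ENNReal.mul_le_mul_iff_right (a := (K : ENNReal))
    (by exact_mod_cast hK₀.ne') (ENNReal.natCast_ne_top K)).1 (hthin.trans ?_)
  rw [← mul_assoc, mul_comm (K : ENNReal)]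
  gcongr

lemma lambdaMin_le_of_mem_stuck (hd : 0 < d) (h : Admissible lam ρ ε ι) (hF : IsSmoothWith F lam)
    (hH : HessianLipschitzNearCritical F ρ ε (locRadius ρ ε ι))
    (hx : ‖gradient F x‖ ≤ ε) (hv : ‖v‖ ≤ pertRadius ε ι) (hstuck : v ∈ stuck F lam ρ ε ι x)
    {j : ℕ} (hj : j ≤ windowLength lam ρ ε ι)
    (hmin : lambdaMin (hessian F ((gradStep F lam)^[j] (x - lam • v))) ≤ -√(ρ * ε)) :
    lambdaMin (hessian F x) ≤ -(√(ρ * ε) / 2) := by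
  have hnear := hH.lambdaMin_le hd h.rho_pos.le hx
    (iterate_mem_ball_of_mem_stuck h hF hx hv hstuck hj)
  have hι := h.le_iota
  have hq := h.sqrt_pos
  have hsmall : √(ρ * ε) / (4 * ι) ≤ √(ρ * ε) / 2 := by gcongr; linarith
  rw [h.rho_mul_locRadius] at hnear
  linarith

lemma apply_iterate_windowLength_le (hd : 0 < d) (h : Admissible lam ρ ε ι)
    (hF : IsSmoothWith F lam) (hH : HessianLipschitzNearCritical F ρ ε (locRadius ρ ε ι))
    (hx : ‖gradient F x‖ ≤ ε) (hv : ‖v‖ ≤ pertRadius ε ι)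
    (hesc : lambdaMin (hessian F x) ≤ -(√(ρ * ε) / 2) → v ∉ stuck F lam ρ ε ι x)
    (hmin : lambdaMin (hessian F x) ≤ -√(ρ * ε) ∨ ∃ j ≤ windowLength lam ρ ε ι,
      lambdaMin (hessian F ((gradStep F lam)^[j] (x - lam • v))) ≤ -√(ρ * ε)) :
    F ((gradStep F lam)^[windowLength lam ρ ε ι] (x - lam • v)) ≤ F x - decrease ρ ε ι / 2 := by
  by_contra! hstuck
  refine hesc ?_ hstuck
  obtain hmin | ⟨j, hj, hmin⟩ := hmin
  · linarith [h.sqrt_pos]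
  · exact lambdaMin_le_of_mem_stuck hd h hF hH hx hv hstuck hj hmin

end Escape

/-! ### Counting bad rounds -/

section Counting

variable {Ψ : ℕ → ℝ} {bad : ℕ → Prop} [DecidablePred bad] {β : ℝ}

lemma mul_count_add_le_of_paid (hΨ : Antitone Ψ) {n k : ℕ}
    (hpaid : ∀ j < k, bad (n + j) → Ψ (n + j + 1) ≤ Ψ (n + j) - β) :
    β * Nat.count bad (n + k) + Ψ (n + k) ≤ β * Nat.count bad n + Ψ n := by
  induction k with
  | zero => rfl
  | succ k ih =>
    specialize ih fun j hj => hpaid j (hj.trans k.lt_succ_self)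
    rw [← add_assoc, Nat.count_succ]
    split_ifs with hbad
    · push_cast
      linarith [hpaid k k.lt_succ_self hbad]
    · rw [add_zero]
      linarith [hΨ (n + k).le_succ]

lemma mul_count_add_le_add_mul (hβ : 0 ≤ β) (n k : ℕ) :
    β * Nat.count bad (n + k) ≤ β * Nat.count bad n + β * k := by
  rw [← mul_add, Nat.count_add]
  gcongr
  exact_mod_cast Nat.add_le_add_left (Nat.count_le _) _

lemma exists_ge_of_forall_lt_exists_gt {D : ℕ → ℝ} {P : ℕ → Prop} {N : ℕ}
    (hnext : ∀ n < N, P n → ∃ n' > n, P n' ∧ D n' ≤ D n) {n : ℕ} (hn : P n) :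
    ∃ n' ≥ N, P n' ∧ D n' ≤ D n := by
  induction hl : N - n using Nat.strong_induction_on generalizing n with
  | _ l ih =>
    obtain hNn | hnN := le_or_gt N n
    · exact ⟨n, hNn, hn, le_rfl⟩
    · obtain ⟨k, hnk, hk, hDk⟩ := hnext n hnN hn
      obtain ⟨n', hn', hPn', hDn'⟩ := ih (N - k) (by omega) hk rfl
      exact ⟨n', hn', hPn', hDn'.trans hDk⟩

end Counting

/-! ### The trajectory -/

/-- The test of the algorithm whether to perturb the state `s` in round `t`. -/
def Perturbs {d : ℕ} (g : Eu d → Eu d) (τ ε : ℝ) (t : ℕ) (s : Eu d × ℕ) : Prop :=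
  ‖g s.1‖ ≤ ε ∧ τ < (t : ℝ) - (s.2 : ℝ)

section State

variable {d : ℕ} {S g : Eu d → Eu d} {η τ ε : ℝ} {x₀ : Eu d} {ξ : ℕ → Eu d} {n : ℕ}

lemma Perturbs.add_floor_lt {s : Eu d × ℕ} (hτ : 0 ≤ τ) (h : Perturbs g τ ε n s) :
    s.2 + ⌊τ⌋₊ < n := by
  have hfloor := Nat.floor_le hτ
  have htest := h.2
  exact_mod_cast (by linarith : (s.2 : ℝ) + ⌊τ⌋₊ < n)

lemma state_succ_of_perturbs (h : Perturbs g τ ε n (state S g η τ ε x₀ ξ n)) :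
    state S g η τ ε x₀ ξ (n + 1) = (S ((state S g η τ ε x₀ ξ n).1 - η • ξ n), n) := by
  unfold Perturbs at h
  rw [state, perturb, if_pos h]

lemma state_succ_of_not_perturbs (h : ¬ Perturbs g τ ε n (state S g η τ ε x₀ ξ n)) :
    state S g η τ ε x₀ ξ (n + 1) =
      (S (state S g η τ ε x₀ ξ n).1, (state S g η τ ε x₀ ξ n).2) := by
  unfold Perturbs at h
  rw [state, perturb, if_neg h]

lemma iteratePost_of_perturbs (h : Perturbs g τ ε n (state S g η τ ε x₀ ξ n)) :
    iteratePost S g η τ ε x₀ ξ n = (state S g η τ ε x₀ ξ n).1 - η • ξ n := by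
  unfold Perturbs at h
  rw [iteratePost, perturb, if_pos h]

lemma iteratePost_of_not_perturbs (h : ¬ Perturbs g τ ε n (state S g η τ ε x₀ ξ n)) :
    iteratePost S g η τ ε x₀ ξ n = (state S g η τ ε x₀ ξ n).1 := by
  unfold Perturbs at h
  rw [iteratePost, perturb, if_neg h]

lemma state_snd_le (n : ℕ) : (state S g η τ ε x₀ ξ n).2 ≤ n := by
  induction n with
  | zero => rfl
  | succ n ih =>
    by_cases h : Perturbs g τ ε n (state S g η τ ε x₀ ξ n)
    · rw [state_succ_of_perturbs h]
      exact n.le_succ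
    · rw [state_succ_of_not_perturbs h]
      exact ih.trans n.le_succ

lemma state_add_eq (hτ : 0 ≤ τ) {s : ℕ} {y : Eu d} (h : state S g η τ ε x₀ ξ n = (y, s)) {j : ℕ}
    (hj : n + j ≤ s + (⌊τ⌋₊ + 1)) : state S g η τ ε x₀ ξ (n + j) = (S^[j] y, s) := by
  induction j with
  | zero => exact h
  | succ j ih =>
    specialize ih (by omega)
    have hnot : ¬ Perturbs g τ ε (n + j) (state S g η τ ε x₀ ξ (n + j)) := fun hpert => by
      have hlt := hpert.add_floor_lt hτ
      rw [ih] at hlt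
      simp only at hlt
      omega
    rw [← add_assoc, state_succ_of_not_perturbs hnot, ih, Function.iterate_succ_apply']

lemma iteratePost_eq_fst (hτ : 0 ≤ τ) (hn : n ≤ (state S g η τ ε x₀ ξ n).2 + ⌊τ⌋₊) :
    iteratePost S g η τ ε x₀ ξ n = (state S g η τ ε x₀ ξ n).1 :=
  iteratePost_of_not_perturbs fun h => hn.not_gt (h.add_floor_lt hτ)

lemma state_add_eq_of_perturbs (hτ : 0 ≤ τ) (h : Perturbs g τ ε n (state S g η τ ε x₀ ξ n))
    {j : ℕ} (hj₀ : 0 < j) (hj : j ≤ ⌊τ⌋₊ + 1) :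
    state S g η τ ε x₀ ξ (n + j) = (S^[j] ((state S g η τ ε x₀ ξ n).1 - η • ξ n), n) := by
  obtain ⟨i, rfl⟩ := Nat.exists_eq_add_of_lt hj₀
  rw [zero_add, Function.iterate_succ_apply, add_comm i, ← add_assoc]
  exact state_add_eq hτ (state_succ_of_perturbs h) (by omega)

lemma iteratePost_add_eq_of_perturbs (hτ : 0 ≤ τ)
    (h : Perturbs g τ ε n (state S g η τ ε x₀ ξ n)) {j : ℕ} (hj : j < ⌊τ⌋₊ + 1) :
    iteratePost S g η τ ε x₀ ξ (n + j) = S^[j] ((state S g η τ ε x₀ ξ n).1 - η • ξ n) := by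
  obtain rfl | hj₀ := j.eq_zero_or_pos
  · exact iteratePost_of_perturbs h
  · have hstate := state_add_eq_of_perturbs hτ h hj₀ hj.le
    rw [iteratePost_eq_fst hτ (by rw [hstate]; simp only; omega), hstate]

end State

/-- The function value, corrected so that a perturbation, which may increase the function value by
`2 * lam * r ^ 2`, does not increase the potential; note that `s.2` grows by at least the window
length with each perturbation. -/
def potential {d : ℕ} (F : Eu d → ℝ) (lam ρ ε ι : ℝ) (s : Eu d × ℕ) : ℝ :=
  F s.1 - 2 * lam * pertRadius ε ι ^ 2 / windowLength lam ρ ε ι * s.2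

/-- The states of perturbed gradient descent on `F` with step size `lam`. -/
def pgdState {d : ℕ} (F : Eu d → ℝ) (lam ρ ε ι : ℝ) (x₀ : Eu d) (ξ : ℕ → Eu d) : ℕ → Eu d × ℕ :=
  state (gradStep F lam) (gradient F) lam (pertInterval lam ρ ε ι) ε x₀ ξ

/-- The iterates of perturbed gradient descent after the possible perturbation of their round. -/
def pgdPost {d : ℕ} (F : Eu d → ℝ) (lam ρ ε ι : ℝ) (x₀ : Eu d) (ξ : ℕ → Eu d) : ℕ → Eu d :=
  iteratePost (gradStep F lam) (gradient F) lam (pertInterval lam ρ ε ι) ε x₀ ξ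

/-- In round `n` of perturbed gradient descent, the iterate is an approximate second-order
stationary point both before and after the perturbation. -/
def SettledAt {d : ℕ} (F : Eu d → ℝ) (lam ρ ε ι : ℝ) (x₀ : Eu d) (ξ : ℕ → Eu d) (n : ℕ) : Prop :=
  Settled F ρ ε (pgdState F lam ρ ε ι x₀ ξ n).1 ∧ Settled F ρ ε (pgdPost F lam ρ ε ι x₀ ξ n)

section Trajectory

variable {d : ℕ} {F : Eu d → ℝ} {lam ρ ε ι : ℝ} {x₀ : Eu d} {ξ : ℕ → Eu d} {n : ℕ}

lemma potential_perturb_le (h : Admissible lam ρ ε ι) (hF : IsSmoothWith F lam) {x v : Eu d}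
    (hv : ‖v‖ ≤ pertRadius ε ι) {s : ℕ} (hs : s + windowLength lam ρ ε ι ≤ n) :
    potential F lam ρ ε ι (gradStep F lam (x - lam • v), n) ≤ potential F lam ρ ε ι (x, s) := by
  have hlam := h.lam_pos
  have hm : (0 : ℝ) < windowLength lam ρ ε ι := by exact_mod_cast windowLength_pos lam ρ ε ι
  have hs' : (s : ℝ) + windowLength lam ρ ε ι ≤ n := by exact_mod_cast hs
  have hcorr : 2 * lam * pertRadius ε ι ^ 2 / windowLength lam ρ ε ι *
      (s + windowLength lam ρ ε ι) ≤
        2 * lam * pertRadius ε ι ^ 2 / windowLength lam ρ ε ι * n := by gcongr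
  rw [mul_add, div_mul_cancel₀ _ hm.ne'] at hcorr
  have hstep := hF.apply_gradStep_sub_smul_le (x := x) hv
  simp only [potential]
  linarith

lemma potential_perturb_le_sub (h : Admissible lam ρ ε ι) (hF : IsSmoothWith F lam)
    {x v : Eu d} (hx : ‖gradient F x‖ ≤ ε) (hv : ‖v‖ ≤ pertRadius ε ι)
    (hlarge : ε < ‖gradient F (x - lam • v)‖) {s : ℕ} (hs : s ≤ n) :
    potential F lam ρ ε ι (gradStep F lam (x - lam • v), n) ≤
      potential F lam ρ ε ι (x, s) - roundDecrease lam ε ι := by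
  have hlam := h.lam_pos
  have hr := h.pertRadius_pos
  have hcorr : 2 * lam * pertRadius ε ι ^ 2 / windowLength lam ρ ε ι * s ≤
      2 * lam * pertRadius ε ι ^ 2 / windowLength lam ρ ε ι * n := by gcongr
  have hstep := hF.apply_gradStep_le_of_lt_norm_gradient h.eps_pos.le hlarge
  have hincrease : lam * (ε * pertRadius ε ι + pertRadius ε ι ^ 2 / 2) ≤
      1 / 100 * (lam * ε ^ 2) := by
    rw [mul_left_comm]
    refine mul_le_mul_of_nonneg_left ?_ hlam.le
    nlinarith [h.pertRadius_le, h.eps_pos]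
  have hmove := hF.apply_sub_smul_le hx hv
  have hround := h.roundDecrease_le
  simp only [potential]
  linarith

lemma potential_gradStep_le (hF : IsSmoothWith F lam) (s : Eu d × ℕ) :
    potential F lam ρ ε ι (gradStep F lam s.1, s.2) ≤ potential F lam ρ ε ι s :=
  sub_le_sub_right (hF.apply_gradStep_le_self _) _

lemma potential_gradStep_le_sub (h : Admissible lam ρ ε ι) (hF : IsSmoothWith F lam)
    {s : Eu d × ℕ} (hlarge : ε < ‖gradient F s.1‖) :
    potential F lam ρ ε ι (gradStep F lam s.1, s.2) ≤
      potential F lam ρ ε ι s - roundDecrease lam ε ι := by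
  have hstep := hF.apply_gradStep_le_of_lt_norm_gradient h.eps_pos.le hlarge
  have hround := h.roundDecrease_le
  have hscale : 0 < lam * ε ^ 2 := mul_pos h.lam_pos (pow_pos h.eps_pos 2)
  simp only [potential]
  linarith

lemma antitone_potential (h : Admissible lam ρ ε ι) (hF : IsSmoothWith F lam)
    (hξ : ∀ n, ‖ξ n‖ ≤ pertRadius ε ι) :
    Antitone fun n => potential F lam ρ ε ι (pgdState F lam ρ ε ι x₀ ξ n) := by
  refine antitone_nat_of_succ_le fun n => ?_
  by_cases hpert : Perturbs (gradient F) (pertInterval lam ρ ε ι) ε n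
    (pgdState F lam ρ ε ι x₀ ξ n)
  · rw [pgdState, state_succ_of_perturbs hpert]
    exact potential_perturb_le h hF (hξ n) (hpert.add_floor_lt h.pertInterval_nonneg)
  · rw [pgdState, state_succ_of_not_perturbs hpert]
    exact potential_gradStep_le hF _

lemma potential_succ_le_sub (h : Admissible lam ρ ε ι) (hF : IsSmoothWith F lam)
    (hξ : ∀ n, ‖ξ n‖ ≤ pertRadius ε ι)
    (hlarge : ε < ‖gradient F (pgdState F lam ρ ε ι x₀ ξ n).1‖ ∨
      ε < ‖gradient F (pgdPost F lam ρ ε ι x₀ ξ n)‖) :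
    potential F lam ρ ε ι (pgdState F lam ρ ε ι x₀ ξ (n + 1)) ≤
      potential F lam ρ ε ι (pgdState F lam ρ ε ι x₀ ξ n) - roundDecrease lam ε ι := by
  by_cases hpert : Perturbs (gradient F) (pertInterval lam ρ ε ι) ε n
    (pgdState F lam ρ ε ι x₀ ξ n)
  · rw [pgdPost, iteratePost_of_perturbs hpert] at hlarge
    rw [pgdState, state_succ_of_perturbs hpert]
    exact potential_perturb_le_sub h hF hpert.1 (hξ n) (hlarge.resolve_left hpert.1.not_gt)
      (state_snd_le n)
  · rw [pgdPost, iteratePost_of_not_perturbs hpert] at hlarge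
    rw [pgdState, state_succ_of_not_perturbs hpert]
    exact potential_gradStep_le_sub h hF (hlarge.elim id id)

lemma lambdaMin_le_of_not_settledAt (h : Admissible lam ρ ε ι) (hF : IsSmoothWith F lam)
    (hξ : ∀ n, ‖ξ n‖ ≤ pertRadius ε ι) (hbad : ¬ SettledAt F lam ρ ε ι x₀ ξ n)
    (hunpaid : ¬ potential F lam ρ ε ι (pgdState F lam ρ ε ι x₀ ξ (n + 1)) ≤
      potential F lam ρ ε ι (pgdState F lam ρ ε ι x₀ ξ n) - roundDecrease lam ε ι) :
    ‖gradient F (pgdState F lam ρ ε ι x₀ ξ n).1‖ ≤ ε ∧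
      (lambdaMin (hessian F (pgdState F lam ρ ε ι x₀ ξ n).1) ≤ -√(ρ * ε) ∨
        lambdaMin (hessian F (pgdPost F lam ρ ε ι x₀ ξ n)) ≤ -√(ρ * ε)) := by
  have hsmall := mt (potential_succ_le_sub h hF hξ) hunpaid
  rw [not_or, not_lt, not_lt] at hsmall
  refine ⟨hsmall.1, ?_⟩
  simpa only [SettledAt, Settled, hsmall.1, hsmall.2, true_and, not_and_or, not_lt] using hbad

lemma apply_le_potential_add (h : Admissible lam ρ ε ι) (hΔ : 0 ≤ gap F x₀) {s : Eu d × ℕ}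
    (hs : s.2 ≤ numIter lam ρ ε ι (gap F x₀)) :
    F s.1 ≤ potential F lam ρ ε ι s + gap F x₀ / 100 := by
  have hlam := h.lam_pos
  have hcorr : 2 * lam * pertRadius ε ι ^ 2 / windowLength lam ρ ε ι * s.2 ≤ gap F x₀ / 100 :=
    le_trans (by gcongr) (h.pertRadius_sq_mul_numIter_le hΔ)
  rw [potential]
  linarith

lemma potential_pgdState_zero : potential F lam ρ ε ι (pgdState F lam ρ ε ι x₀ ξ 0) = F x₀ := by
  simp [potential, pgdState, state]

lemma gap_nonneg (hbdd : BddBelow (Set.range F)) : 0 ≤ gap F x₀ :=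
  sub_nonneg.2 (ciInf_le hbdd x₀)

lemma decrease_le_gap (hd : 0 < d) (h : Admissible lam ρ ε ι) (hF : IsSmoothWith F lam)
    (hH : HessianLipschitzNearCritical F ρ ε (locRadius ρ ε ι)) (hbdd : BddBelow (Set.range F))
    (hξ : ∀ n, ‖ξ n‖ ≤ pertRadius ε ι)
    (hn : (pgdState F lam ρ ε ι x₀ ξ n).2 ≤ numIter lam ρ ε ι (gap F x₀))
    (hgrad : ‖gradient F (pgdState F lam ρ ε ι x₀ ξ n).1‖ ≤ ε)
    (hmin : lambdaMin (hessian F (pgdState F lam ρ ε ι x₀ ξ n).1) ≤ -(√(ρ * ε) / 2)) :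
    decrease ρ ε ι ≤ gap F x₀ := by
  have hΔ : 0 ≤ gap F x₀ := gap_nonneg hbdd
  obtain ⟨y, hy⟩ := exists_le_sub_decrease hd h hF hH hgrad hmin
  have hvalue := apply_le_potential_add h hΔ hn
  have hstart := antitone_potential h hF hξ (x₀ := x₀) n.zero_le
  simp only [potential_pgdState_zero] at hstart
  have hinf := ciInf_le hbdd y
  have hgap : F x₀ - ⨅ x, F x = gap F x₀ := rfl
  linarith [h.decrease_pos]

/-- The number of rounds before `n` which are not settled. -/
def unsettledCount {d : ℕ} (F : Eu d → ℝ) (lam ρ ε ι : ℝ) (x₀ : Eu d) (ξ : ℕ → Eu d) (n : ℕ) : ℕ :=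
  open scoped Classical in Nat.count (fun j => ¬ SettledAt F lam ρ ε ι x₀ ξ j) n

/-- The potential, charged with `roundDecrease` for every earlier round which is not settled. -/
def chargedPotential {d : ℕ} (F : Eu d → ℝ) (lam ρ ε ι : ℝ) (x₀ : Eu d) (ξ : ℕ → Eu d) (n : ℕ) :
    ℝ :=
  roundDecrease lam ε ι * unsettledCount F lam ρ ε ι x₀ ξ n +
    potential F lam ρ ε ι (pgdState F lam ρ ε ι x₀ ξ n)

lemma chargedPotential_zero : chargedPotential F lam ρ ε ι x₀ ξ 0 = F x₀ := by
  simp [chargedPotential, unsettledCount, potential_pgdState_zero]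

lemma chargedPotential_add_le_of_paid (h : Admissible lam ρ ε ι) (hF : IsSmoothWith F lam)
    (hξ : ∀ n, ‖ξ n‖ ≤ pertRadius ε ι) {k : ℕ}
    (hpaid : ∀ j < k, ¬ SettledAt F lam ρ ε ι x₀ ξ (n + j) →
      potential F lam ρ ε ι (pgdState F lam ρ ε ι x₀ ξ (n + j + 1)) ≤
        potential F lam ρ ε ι (pgdState F lam ρ ε ι x₀ ξ (n + j)) - roundDecrease lam ε ι) :
    chargedPotential F lam ρ ε ι x₀ ξ (n + k) ≤ chargedPotential F lam ρ ε ι x₀ ξ n := by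
  classical
  exact mul_count_add_le_of_paid (antitone_potential h hF hξ) hpaid

lemma chargedPotential_succ_le (h : Admissible lam ρ ε ι) (hF : IsSmoothWith F lam)
    (hξ : ∀ n, ‖ξ n‖ ≤ pertRadius ε ι)
    (hlarge : ε < ‖gradient F (pgdState F lam ρ ε ι x₀ ξ n).1‖) :
    chargedPotential F lam ρ ε ι x₀ ξ (n + 1) ≤ chargedPotential F lam ρ ε ι x₀ ξ n := by
  refine chargedPotential_add_le_of_paid h hF hξ fun j hj _ => ?_
  obtain rfl := Nat.lt_one_iff.1 hj
  exact potential_succ_le_sub h hF hξ (Or.inl hlarge)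

lemma chargedPotential_add_le_of_potential_le (h : Admissible lam ρ ε ι) {k : ℕ} {D : ℝ}
    (hk : roundDecrease lam ε ι * k ≤ D)
    (hpot : potential F lam ρ ε ι (pgdState F lam ρ ε ι x₀ ξ (n + k)) ≤
      potential F lam ρ ε ι (pgdState F lam ρ ε ι x₀ ξ n) - D) :
    chargedPotential F lam ρ ε ι x₀ ξ (n + k) ≤ chargedPotential F lam ρ ε ι x₀ ξ n := by
  classical
  have hcount : roundDecrease lam ε ι * unsettledCount F lam ρ ε ι x₀ ξ (n + k) ≤ _ :=
    mul_count_add_le_add_mul h.roundDecrease_pos.le n k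
  simp only [chargedPotential, unsettledCount] at hcount ⊢
  linarith

lemma potential_add_windowLength_le_sub (hd : 0 < d) (h : Admissible lam ρ ε ι)
    (hF : IsSmoothWith F lam) (hH : HessianLipschitzNearCritical F ρ ε (locRadius ρ ε ι))
    (hξ : ‖ξ n‖ ≤ pertRadius ε ι)
    (hpert : Perturbs (gradient F) (pertInterval lam ρ ε ι) ε n (pgdState F lam ρ ε ι x₀ ξ n))
    (hesc : lambdaMin (hessian F (pgdState F lam ρ ε ι x₀ ξ n).1) ≤ -(√(ρ * ε) / 2) →
      ξ n ∉ stuck F lam ρ ε ι (pgdState F lam ρ ε ι x₀ ξ n).1)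
    (hmin : lambdaMin (hessian F (pgdState F lam ρ ε ι x₀ ξ n).1) ≤ -√(ρ * ε) ∨
      ∃ j ≤ windowLength lam ρ ε ι, lambdaMin (hessian F ((gradStep F lam)^[j]
        ((pgdState F lam ρ ε ι x₀ ξ n).1 - lam • ξ n))) ≤ -√(ρ * ε)) :
    potential F lam ρ ε ι (pgdState F lam ρ ε ι x₀ ξ (n + windowLength lam ρ ε ι)) ≤
      potential F lam ρ ε ι (pgdState F lam ρ ε ι x₀ ξ n) - decrease ρ ε ι / 2 := by
  have hlam := h.lam_pos
  have hs : (pgdState F lam ρ ε ι x₀ ξ n).2 ≤ n := state_snd_le n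
  have hstate : pgdState F lam ρ ε ι x₀ ξ (n + windowLength lam ρ ε ι) =
      ((gradStep F lam)^[windowLength lam ρ ε ι]
        ((pgdState F lam ρ ε ι x₀ ξ n).1 - lam • ξ n), n) :=
    state_add_eq_of_perturbs h.pertInterval_nonneg hpert (windowLength_pos lam ρ ε ι) le_rfl
  rw [hstate, potential, potential, sub_right_comm]
  gcongr
  exact apply_iterate_windowLength_le hd h hF hH hpert.1 hξ hesc hmin

lemma chargedPotential_add_windowLength_le (hd : 0 < d) (h : Admissible lam ρ ε ι)
    (hF : IsSmoothWith F lam) (hH : HessianLipschitzNearCritical F ρ ε (locRadius ρ ε ι))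
    (hξ : ∀ n, ‖ξ n‖ ≤ pertRadius ε ι)
    (hpert : Perturbs (gradient F) (pertInterval lam ρ ε ι) ε n (pgdState F lam ρ ε ι x₀ ξ n))
    (hesc : lambdaMin (hessian F (pgdState F lam ρ ε ι x₀ ξ n).1) ≤ -(√(ρ * ε) / 2) →
      ξ n ∉ stuck F lam ρ ε ι (pgdState F lam ρ ε ι x₀ ξ n).1) :
    chargedPotential F lam ρ ε ι x₀ ξ (n + windowLength lam ρ ε ι) ≤
      chargedPotential F lam ρ ε ι x₀ ξ n := by
  by_cases hpaid : ∀ j < windowLength lam ρ ε ι, ¬ SettledAt F lam ρ ε ι x₀ ξ (n + j) →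
    potential F lam ρ ε ι (pgdState F lam ρ ε ι x₀ ξ (n + j + 1)) ≤
      potential F lam ρ ε ι (pgdState F lam ρ ε ι x₀ ξ (n + j)) - roundDecrease lam ε ι
  · exact chargedPotential_add_le_of_paid h hF hξ hpaid
  push Not at hpaid
  obtain ⟨j, hj, hbad, hunpaid⟩ := hpaid
  have hτ := h.pertInterval_nonneg
  refine chargedPotential_add_le_of_potential_le h h.roundDecrease_mul_windowLength_le
    (potential_add_windowLength_le_sub hd h hF hH (hξ n) hpert hesc ?_)
  obtain hpre | hpost := (lambdaMin_le_of_not_settledAt h hF hξ hbad hunpaid.not_ge).2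
  · obtain rfl | hj₀ := j.eq_zero_or_pos
    · exact Or.inl hpre
    · rw [pgdState, state_add_eq_of_perturbs hτ hpert hj₀ hj.le] at hpre
      exact Or.inr ⟨j, hj.le, hpre⟩
  · rw [pgdPost, iteratePost_add_eq_of_perturbs hτ hpert hj] at hpost
    exact Or.inr ⟨j, hj.le, hpost⟩

/-- In round `n` a perturbation is due as soon as the gradient is small, and the last perturbation
was not later than `numIter`. -/
def IsCheckpoint {d : ℕ} (F : Eu d → ℝ) (lam ρ ε ι : ℝ) (x₀ : Eu d) (ξ : ℕ → Eu d) (n : ℕ) : Prop :=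
  pertInterval lam ρ ε ι < (n : ℝ) - (pgdState F lam ρ ε ι x₀ ξ n).2 ∧
    (pgdState F lam ρ ε ι x₀ ξ n).2 ≤ numIter lam ρ ε ι (gap F x₀)

lemma exists_isCheckpoint_gt (hd : 0 < d) (h : Admissible lam ρ ε ι) (hF : IsSmoothWith F lam)
    (hH : HessianLipschitzNearCritical F ρ ε (locRadius ρ ε ι)) (hbdd : BddBelow (Set.range F))
    (hξ : ∀ n, ‖ξ n‖ ≤ pertRadius ε ι) (hn : n ≤ numIter lam ρ ε ι (gap F x₀))
    (hesc : ‖gradient F (pgdState F lam ρ ε ι x₀ ξ n).1‖ ≤ ε →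
      lambdaMin (hessian F (pgdState F lam ρ ε ι x₀ ξ n).1) ≤ -(√(ρ * ε) / 2) →
      decrease ρ ε ι ≤ gap F x₀ → ξ n ∉ stuck F lam ρ ε ι (pgdState F lam ρ ε ι x₀ ξ n).1)
    (hcheck : IsCheckpoint F lam ρ ε ι x₀ ξ n) :
    ∃ n' > n, IsCheckpoint F lam ρ ε ι x₀ ξ n' ∧
      chargedPotential F lam ρ ε ι x₀ ξ n' ≤ chargedPotential F lam ρ ε ι x₀ ξ n := by
  obtain ⟨hdue, hlast⟩ := hcheck
  obtain hlarge | hsmall := lt_or_ge ε ‖gradient F (pgdState F lam ρ ε ι x₀ ξ n).1‖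
  · have hnot : ¬ Perturbs (gradient F) (pertInterval lam ρ ε ι) ε n
        (pgdState F lam ρ ε ι x₀ ξ n) := fun hpert => hpert.1.not_gt hlarge
    refine ⟨n + 1, n.lt_succ_self, ?_, chargedPotential_succ_le h hF hξ hlarge⟩
    rw [IsCheckpoint, pgdState, state_succ_of_not_perturbs hnot, Nat.cast_succ]
    exact ⟨by simp only [pgdState] at hdue; linarith, hlast⟩
  · have hm := windowLength_pos lam ρ ε ι
    refine ⟨n + windowLength lam ρ ε ι, by omega, ?_,
      chargedPotential_add_windowLength_le hd h hF hH hξ ⟨hsmall, hdue⟩ fun hmin =>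
        hesc hsmall hmin (decrease_le_gap hd h hF hH hbdd hξ hlast hsmall hmin)⟩
    rw [IsCheckpoint, pgdState,
      state_add_eq_of_perturbs h.pertInterval_nonneg ⟨hsmall, hdue⟩ hm le_rfl, Nat.cast_add,
      add_sub_cancel_left]
    exact ⟨pertInterval_lt_windowLength lam ρ ε ι, hn⟩

lemma pgdState_eq_of_le (h : Admissible lam ρ ε ι) (hn : n ≤ windowLength lam ρ ε ι) :
    pgdState F lam ρ ε ι x₀ ξ n = ((gradStep F lam)^[n] x₀, 0) := by
  have hstart : state (gradStep F lam) (gradient F) lam (pertInterval lam ρ ε ι) ε x₀ ξ 0 =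
    (x₀, 0) := rfl
  have hstate := state_add_eq h.pertInterval_nonneg hstart (j := n) (by rwa [zero_add, zero_add])
  rwa [zero_add] at hstate

lemma isCheckpoint_windowLength (h : Admissible lam ρ ε ι) (hΔ : 0 ≤ gap F x₀) :
    IsCheckpoint F lam ρ ε ι x₀ ξ (windowLength lam ρ ε ι) := by
  rw [IsCheckpoint, pgdState_eq_of_le h le_rfl, Nat.cast_zero, sub_zero]
  exact ⟨pertInterval_lt_windowLength lam ρ ε ι, h.numIter_nonneg hΔ⟩

lemma chargedPotential_windowLength_le (hd : 0 < d) (h : Admissible lam ρ ε ι)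
    (hF : IsSmoothWith F lam) (hH : HessianLipschitzNearCritical F ρ ε (locRadius ρ ε ι))
    (hbdd : BddBelow (Set.range F)) (hξ : ∀ n, ‖ξ n‖ ≤ pertRadius ε ι) :
    chargedPotential F lam ρ ε ι x₀ ξ (windowLength lam ρ ε ι) ≤
      F x₀ + roundDecrease lam ε ι * (1001 / 8000 * numIter lam ρ ε ι (gap F x₀)) := by
  have hround := h.roundDecrease_pos.le
  have hT := h.numIter_nonneg (gap_nonneg hbdd (x₀ := x₀))
  by_cases hpaid : ∀ j < windowLength lam ρ ε ι, ¬ SettledAt F lam ρ ε ι x₀ ξ (0 + j) →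
    potential F lam ρ ε ι (pgdState F lam ρ ε ι x₀ ξ (0 + j + 1)) ≤
      potential F lam ρ ε ι (pgdState F lam ρ ε ι x₀ ξ (0 + j)) - roundDecrease lam ε ι
  · have hpotential := chargedPotential_add_le_of_paid h hF hξ hpaid
    rw [zero_add, chargedPotential_zero] at hpotential
    exact le_add_of_le_of_nonneg hpotential (by positivity)
  push Not at hpaid
  simp only [zero_add] at hpaid
  obtain ⟨j, hj, hbad, hunpaid⟩ := hpaid
  obtain ⟨hgrad, hmin⟩ := lambdaMin_le_of_not_settledAt h hF hξ hbad hunpaid.not_ge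
  have hlast : (pgdState F lam ρ ε ι x₀ ξ j).2 = 0 := by rw [pgdState_eq_of_le h hj.le]
  have hpost : pgdPost F lam ρ ε ι x₀ ξ j = (pgdState F lam ρ ε ι x₀ ξ j).1 :=
    iteratePost_eq_fst h.pertInterval_nonneg (Nat.lt_succ_iff.1 hj |>.trans (Nat.le_add_left _ _))
  rw [hpost, or_self] at hmin
  have hgap : decrease ρ ε ι ≤ gap F x₀ :=
    decrease_le_gap hd h hF hH hbdd hξ (by rwa [hlast, Nat.cast_zero]) hgrad
      (hmin.trans (by linarith [h.sqrt_pos]))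
  have hm : (windowLength lam ρ ε ι : ℝ) ≤ 1001 / 8000 * numIter lam ρ ε ι (gap F x₀) := by
    linarith [h.windowLength_le_numIter hgap]
  have hcount : (unsettledCount F lam ρ ε ι x₀ ξ (windowLength lam ρ ε ι) : ℝ) ≤
      windowLength lam ρ ε ι := by
    classical
    exact_mod_cast Nat.count_le _
  have hpotential := antitone_potential h hF hξ (x₀ := x₀) (windowLength lam ρ ε ι).zero_le
  simp only [potential_pgdState_zero] at hpotential
  rw [chargedPotential, add_comm]
  gcongr
  exact hcount.trans hm

lemma unsettledCount_add_ncard (N : ℕ) :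
    unsettledCount F lam ρ ε ι x₀ ξ N + {n | n < N ∧ SettledAt F lam ρ ε ι x₀ ξ n}.ncard = N := by
  classical
  have hset : {n | n < N ∧ SettledAt F lam ρ ε ι x₀ ξ n} =
      {n ∈ Finset.range N | SettledAt F lam ρ ε ι x₀ ξ n} := by
    ext n
    simp
  rw [hset, Set.ncard_coe_finset, unsettledCount, Nat.count_eq_card_filter_range, add_comm]
  convert Finset.card_filter_add_card_filter_not _
  exact (Finset.card_range N).symm

lemma half_le_ncard_settledAt (hd : 0 < d) (h : Admissible lam ρ ε ι) (hF : IsSmoothWith F lam)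
    (hH : HessianLipschitzNearCritical F ρ ε (locRadius ρ ε ι)) (hbdd : BddBelow (Set.range F))
    (hξ : ∀ n, ‖ξ n‖ ≤ pertRadius ε ι) {N : ℕ} (hN : N = ⌈numIter lam ρ ε ι (gap F x₀)⌉₊)
    (hesc : ∀ n < N, ‖gradient F (pgdState F lam ρ ε ι x₀ ξ n).1‖ ≤ ε →
      lambdaMin (hessian F (pgdState F lam ρ ε ι x₀ ξ n).1) ≤ -(√(ρ * ε) / 2) →
      decrease ρ ε ι ≤ gap F x₀ → ξ n ∉ stuck F lam ρ ε ι (pgdState F lam ρ ε ι x₀ ξ n).1) :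
    (N : ℝ) / 2 ≤ {n | n < N ∧ SettledAt F lam ρ ε ι x₀ ξ n}.ncard := by
  have hΔ : 0 ≤ gap F x₀ := gap_nonneg hbdd
  have hceil : numIter lam ρ ε ι (gap F x₀) ≤ N := hN ▸ Nat.le_ceil _
  obtain ⟨n, hn, hcheck, hcharged⟩ := exists_ge_of_forall_lt_exists_gt (N := N)
    (fun n hn => exists_isCheckpoint_gt hd h hF hH hbdd hξ
      (Nat.lt_ceil.1 (hN ▸ hn)).le (hesc n hn))
    (isCheckpoint_windowLength h hΔ)
  have hstart := hcharged.trans (chargedPotential_windowLength_le hd h hF hH hbdd hξ)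
  have hvalue := apply_le_potential_add h hΔ hcheck.2
  have hinf := ciInf_le hbdd (pgdState F lam ρ ε ι x₀ ξ n).1
  have hgap : F x₀ - ⨅ x, F x = gap F x₀ := rfl
  have hmono : roundDecrease lam ε ι * unsettledCount F lam ρ ε ι x₀ ξ N ≤
      roundDecrease lam ε ι * unsettledCount F lam ρ ε ι x₀ ξ n := by
    have hround := h.roundDecrease_pos
    classical
    gcongr
    exact Nat.count_monotone _ hn
  have hcount : (unsettledCount F lam ρ ε ι x₀ ξ N : ℝ) ≤
      (10201 / 40000 + 1001 / 8000) * numIter lam ρ ε ι (gap F x₀) := by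
    refine le_of_mul_le_mul_left ?_ h.roundDecrease_pos
    have hbudget := h.roundDecrease_mul_numIter hΔ
    rw [chargedPotential] at hstart
    linarith
  have hsum : (unsettledCount F lam ρ ε ι x₀ ξ N : ℝ) +
      {n | n < N ∧ SettledAt F lam ρ ε ι x₀ ξ n}.ncard = N := by
    exact_mod_cast unsettledCount_add_ncard N
  linarith

end Trajectory

/-! ### The probability that all perturbations succeed -/

section UniformLaw

variable {Ω E E' : Type*} [MeasurableSpace Ω] {P : Measure Ω} [MeasurableSpace E]
  [MeasurableSpace E']

lemma map_apply_le_of_isUniform {μ : Measure E} {V : Ω → E} {s W : Set E}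
    (hV : pdf.IsUniform V s P μ) (hs : MeasurableSet s) (hs₀ : μ s ≠ 0) (hs' : μ s ≠ ⊤)
    {c : ENNReal} (hW : μ (W ∩ s) ≤ c * μ s) : P.map V W ≤ c := by
  rw [hV, cond_apply hs, Set.inter_comm, ENNReal.inv_mul_le_iff hs₀ hs', mul_comm]
  exact hW

lemma ae_mem_of_isUniform {μ : Measure E} {V : Ω → E} {s : Set E} (hV : pdf.IsUniform V s P μ)
    (hs : MeasurableSet s) (hVm : AEMeasurable V P) : ∀ᵐ ω ∂P, V ω ∈ s := by
  refine ae_of_ae_map hVm ?_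
  rw [hV]
  exact ae_cond_mem hs

/-- The points with a small section will be described by the Hessian, which is not known to be
measurable; therefore the event refers to the size of the section itself. -/
lemma measure_map_section_le_and_mem_le [IsProbabilityMeasure P] {X : Ω → E} {V : Ω → E'}
    (hX : Measurable X) (hV : Measurable V) (hXV : IndepFun X V P) {B : Set (E × E')}
    (hB : MeasurableSet B) (c : ENNReal) :
    P {ω | P.map V (Prod.mk (X ω) ⁻¹' B) ≤ c ∧ (X ω, V ω) ∈ B} ≤ c := by
  have := Measure.isProbabilityMeasure_map (μ := P) hV.aemeasurable
  have := Measure.isProbabilityMeasure_map (μ := P) hX.aemeasurable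
  set C : Set (E × E') := {p | P.map V (Prod.mk p.1 ⁻¹' B) ≤ c} ∩ B
  have hC : MeasurableSet C :=
    (measurableSet_le ((measurable_measure_prodMk_left hB).comp measurable_fst)
      measurable_const).inter hB
  have hsection (x : E) : P.map V (Prod.mk x ⁻¹' C) ≤ c := by
    by_cases hx : P.map V (Prod.mk x ⁻¹' B) ≤ c
    · exact (measure_mono fun v hv => hv.2).trans hx
    · have hempty : Prod.mk x ⁻¹' C = ∅ := Set.eq_empty_of_forall_notMem fun v hv => hx hv.1
      rw [hempty, measure_empty]
      exact zero_le
  calc P ((fun ω => (X ω, V ω)) ⁻¹' C)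
      = ∫⁻ x, P.map V (Prod.mk x ⁻¹' C) ∂(P.map X) := by
        rw [← Measure.map_apply (hX.prodMk hV) hC,
          (indepFun_iff_map_prod_eq_prod_map_map hX.aemeasurable hV.aemeasurable).1 hXV,
          Measure.prod_apply hC]
    _ ≤ ∫⁻ _, c ∂(P.map X) := lintegral_mono hsection
    _ = c := by rw [lintegral_const, measure_univ, mul_one]

lemma ofReal_one_sub_le_measure [IsProbabilityMeasure P] {A : ℕ → Set Ω} {N : ℕ} {δ : ℝ}
    (hδ : 0 ≤ δ) (hA : ∀ n < N, P (A n) ≤ ENNReal.ofReal (δ / N)) {s : Set Ω}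
    (hs : ∀ᵐ ω ∂P, (∀ n < N, ω ∉ A n) → ω ∈ s) : ENNReal.ofReal (1 - δ) ≤ P s := by
  have hcompl : P sᶜ ≤ ENNReal.ofReal δ :=
    calc P sᶜ ≤ P (⋃ n ∈ Finset.range N, A n) := by
          refine measure_mono_ae (hs.mono fun ω hω hωs => ?_)
          by_contra hωA
          exact hωs (hω fun n hn hωn => hωA (Set.mem_biUnion (Finset.mem_range.2 hn) hωn))
      _ ≤ ∑ n ∈ Finset.range N, P (A n) := measure_biUnion_finset_le _ _
      _ ≤ ∑ _n ∈ Finset.range N, ENNReal.ofReal (δ / N) :=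
          Finset.sum_le_sum fun n hn => hA n (Finset.mem_range.1 hn)
      _ = ENNReal.ofReal (N * (δ / N)) := by
          rw [Finset.sum_const, Finset.card_range, nsmul_eq_mul,
            ENNReal.ofReal_mul N.cast_nonneg, ENNReal.ofReal_natCast]
      _ ≤ ENNReal.ofReal δ := by
          rw [mul_div_left_comm]
          exact ENNReal.ofReal_le_ofReal (mul_le_of_le_one_right hδ (div_self_le_one _))
  rw [ENNReal.ofReal_sub _ hδ, ENNReal.ofReal_one, tsub_le_iff_left, ← measure_univ (μ := P)]
  exact (measure_univ_le_add_compl s).trans (by rw [add_comm]; gcongr)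

end UniformLaw

section Noise

variable {d : ℕ} {S g : Eu d → Eu d} {η τ ε : ℝ} {x₀ : Eu d}

lemma state_congr {ξ ξ' : ℕ → Eu d} {n : ℕ} (h : ∀ t < n, ξ t = ξ' t) :
    state S g η τ ε x₀ ξ n = state S g η τ ε x₀ ξ' n := by
  induction n with
  | zero => rfl
  | succ n ih =>
    rw [state, state, ih fun t ht => h t (ht.trans n.lt_succ_self), h n n.lt_succ_self]

lemma measurable_perturb (hg : Measurable g) (t : ℕ) :
    Measurable fun p : Eu d × (Eu d × ℕ) => perturb g η τ ε p.1 t p.2 := by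
  have hsmall : Measurable fun p : Eu d × (Eu d × ℕ) => ‖g p.2.1‖ := by fun_prop
  have hdue : Measurable fun p : Eu d × (Eu d × ℕ) => (t : ℝ) - p.2.2 := by fun_prop
  exact Measurable.ite ((measurableSet_le hsmall measurable_const).inter
    (measurableSet_lt measurable_const hdue)) (by fun_prop) (by fun_prop)

lemma measurable_state (hS : Measurable S) (hg : Measurable g) (n : ℕ) :
    Measurable fun ξ : ℕ → Eu d => state S g η τ ε x₀ ξ n := by
  induction n with
  | zero => exact measurable_const
  | succ n ih =>
    have hpert := (measurable_perturb (η := η) (τ := τ) (ε := ε) hg n).comp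
      ((measurable_pi_apply n).prodMk ih)
    exact (hS.comp hpert.fst).prodMk hpert.snd

lemma indepFun_state {Ω : Type*} [MeasurableSpace Ω] {P : Measure Ω} {ξ : ℕ → Ω → Eu d}
    (hξm : ∀ t, Measurable (ξ t)) (hind : iIndepFun ξ P) (hS : Measurable S) (hg : Measurable g)
    (n : ℕ) : IndepFun (fun ω => state S g η τ ε x₀ (fun t => ξ t ω) n) (ξ n) P := by
  let extend (z : Finset.range n → Eu d) (t : ℕ) : Eu d :=
    if ht : t ∈ Finset.range n then z ⟨t, ht⟩ else 0
  have hextend : Measurable extend := by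
    refine measurable_pi_iff.2 fun t => ?_
    by_cases ht : t ∈ Finset.range n
    · simp only [extend, ht, dite_true]
      exact measurable_pi_apply _
    · simp only [extend, ht, dite_false]
      exact measurable_const
  have hpast := (hind.indepFun_finset (Finset.range n) {n} (by simp) hξm).comp
    ((measurable_state (η := η) (τ := τ) (ε := ε) (x₀ := x₀) hS hg n).comp hextend)
    (measurable_pi_apply (⟨n, Finset.mem_singleton_self n⟩ : ({n} : Finset ℕ)))
  have hstate (ω : Ω) : state S g η τ ε x₀ (fun t => ξ t ω) n =
      state S g η τ ε x₀ (extend fun t => ξ t ω) n :=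
    state_congr fun t ht => by simp [extend, ht]
  simp only [hstate]
  exact hpast

end Noise

section PerturbedGradientDescent

variable {d : ℕ} {F : Eu d → ℝ} {lam ρ ε ι δ : ℝ} {x₀ : Eu d} {Ω : Type*} [MeasurableSpace Ω]
  {P : Measure Ω}

lemma map_apply_stuck_le (hd : 0 < d) (h : Admissible lam ρ ε ι) (hF : IsSmoothWith F lam)
    (hH : HessianLipschitzNearCritical F ρ ε (locRadius ρ ε ι)) {x : Eu d}
    (hx : ‖gradient F x‖ ≤ ε) (hmin : lambdaMin (hessian F x) ≤ -(√(ρ * ε) / 2)) {p : ℝ}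
    (hp₀ : 0 < p) (hp₁ : p ≤ 1) (hsep : d * (6 / p * separation lam ρ ε ι) ≤ pertRadius ε ι)
    {V : Ω → Eu d} (hV : pdf.IsUniform V (Metric.closedBall 0 (pertRadius ε ι)) P volume) :
    P.map V (stuck F lam ρ ε ι x) ≤ ENNReal.ofReal p :=
  map_apply_le_of_isUniform hV measurableSet_closedBall
    (Metric.measure_closedBall_pos volume 0 h.pertRadius_pos).ne' measure_closedBall_lt_top.ne
    (volume_stuck_le hd h hF hH hx hmin hp₀ hp₁ hsep)

theorem ofReal_one_sub_le_measure_half_le_ncard_settledAt [IsProbabilityMeasure P] (hd : 0 < d)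
    (h : Admissible lam ρ ε ι) (hF : IsSmoothWith F lam)
    (hH : HessianLipschitzNearCritical F ρ ε (locRadius ρ ε ι)) (hbdd : BddBelow (Set.range F))
    (hδ₀ : 0 < δ) (hδ₁ : δ ≤ 1)
    (hι : 10 ^ 30 * max 1 (Real.log (d * gap F x₀ / (lam * ε ^ 2 * δ))) ≤ ι) {N : ℕ}
    (hN : N = ⌈numIter lam ρ ε ι (gap F x₀)⌉₊) {ξ : ℕ → Ω → Eu d}
    (hξm : ∀ t, Measurable (ξ t)) (hind : iIndepFun ξ P)
    (hξ : ∀ t, pdf.IsUniform (ξ t) (Metric.closedBall 0 (pertRadius ε ι)) P volume) :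
    ENNReal.ofReal (1 - δ) ≤ P {ω | (N : ℝ) / 2 ≤
      {n | n < N ∧ SettledAt F lam ρ ε ι x₀ (fun t => ξ t ω) n}.ncard} := by
  have hstate (n : ℕ) : Measurable fun ω => (pgdState F lam ρ ε ι x₀ (fun t => ξ t ω) n).1 :=
    ((measurable_state hF.continuous_gradStep.measurable
      hF.lipschitzWith_gradient.continuous.measurable n).comp (measurable_pi_iff.2 hξm)).fst
  have hindep (n : ℕ) :
      IndepFun (fun ω => (pgdState F lam ρ ε ι x₀ (fun t => ξ t ω) n).1) (ξ n) P :=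
    (indepFun_state hξm hind hF.continuous_gradStep.measurable
      hF.lipschitzWith_gradient.continuous.measurable n).comp measurable_fst measurable_id
  refine ofReal_one_sub_le_measure hδ₀.le (fun n _ => measure_map_section_le_and_mem_le (hstate n)
    (hξm n) (hindep n) (isOpen_stuck hF (ρ := ρ) (ε := ε) (ι := ι)).measurableSet
      (ENNReal.ofReal (δ / N))) ?_
  have hball : ∀ᵐ ω ∂P, ∀ n, ξ n ω ∈ Metric.closedBall 0 (pertRadius ε ι) :=
    ae_all_iff.2 fun n => ae_mem_of_isUniform (hξ n) measurableSet_closedBall (hξm n).aemeasurable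
  filter_upwards [hball] with ω hω hlucky
  refine half_le_ncard_settledAt hd h hF hH hbdd (fun n => mem_closedBall_zero_iff.1 (hω n)) hN
    fun n hn hgrad hmin hgap hstuck => hlucky n hn ⟨?_, hstuck⟩
  have hN₀ : (1 : ℝ) ≤ N := by exact_mod_cast (Nat.zero_le n).trans_lt hn
  have hNT : (N : ℝ) ≤ numIter lam ρ ε ι (gap F x₀) + 1 :=
    hN ▸ (Nat.ceil_lt_add_one (h.numIter_nonneg (gap_nonneg hbdd))).le
  refine map_apply_stuck_le hd h hF hH hgrad hmin (by positivity)
    ((div_le_self hδ₀.le hN₀).trans hδ₁) ?_ (hξ n)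
  rw [div_div_eq_mul_div]
  exact h.natCast_mul_separation_le hgap hd hδ₀ hδ₁ hι hNT

end PerturbedGradientDescent

lemma halfGood_of_half_le_ncard_settledAt {d : ℕ} (hd : 0 < d) {f : Eu d → EReal}
    {lam ρ ε ι : ℝ} {x₀ : Eu d} {ξ : ℕ → Eu d} {N : ℕ}
    (hprox : prox f lam = gradStep (moreau f lam) lam) (h : Admissible lam ρ ε ι)
    (hH : HessianLipschitzNearCritical (moreau f lam) ρ ε (locRadius ρ ε ι))
    (hN : (N : ℝ) / 2 ≤ {n | n < N ∧ SettledAt (moreau f lam) lam ρ ε ι x₀ ξ n}.ncard) :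
    HalfGood f lam ρ ε ι x₀ ξ N := by
  have hgood {x : Eu d} (hx : Settled (moreau f lam) ρ ε x) : Good f lam ρ ε x :=
    good_of_settled hd hprox h.lam_pos h.locRadius_pos hH hx
  refine hN.trans ?_
  rw [hprox]
  exact Nat.cast_le.2 (Set.ncard_le_ncard (fun n hn => ⟨hn.1, hgood hn.2.1, hgood hn.2.2⟩)
    ((Set.finite_lt_nat N).subset fun n hn => hn.1))

/-! ### The order of the number of iterations -/

lemma max_one_log_mul_le {d y : ℝ} (hd : 2 ≤ d) (hy : 0 ≤ y) :
    max 1 (Real.log (d * y)) ≤ (Real.log 2)⁻¹ * Real.log d * (1 + Real.posLog y) := by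
  have hlog₂ : 0 < Real.log 2 := Real.log_pos one_lt_two
  have hlogd : 1 ≤ (Real.log 2)⁻¹ * Real.log d := by
    rw [inv_mul_eq_div, one_le_div₀ hlog₂]
    exact Real.log_le_log two_pos hd
  have hlogd' : Real.log d ≤ (Real.log 2)⁻¹ * Real.log d := by
    refine le_mul_of_one_le_left (Real.log_nonneg (by linarith)) ?_
    rw [one_le_inv₀ hlog₂]
    linarith [Real.log_two_lt_d9]
  have hpos : 0 ≤ Real.posLog y := Real.posLog_nonneg
  have hmul : Real.log (d * y) ≤ Real.log d + Real.posLog y := by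
    obtain rfl | hy := hy.eq_or_lt
    · rw [mul_zero, Real.log_zero]
      exact add_nonneg (Real.log_nonneg (by linarith)) hpos
    · rw [Real.log_mul (by positivity) hy.ne', Real.posLog_def]
      gcongr
      exact le_max_right _ _
  refine max_le ?_ ?_ <;> nlinarith

lemma numIter_mul_max_one_log_le {c : ℝ} (hc : 1 ≤ c) {d lam ρ ε δ Δ : ℝ} (hd : 2 ≤ d)
    (hlam : 0 < lam) (hρ : 0 < ρ) (hε : 0 < ε) (hδ : 0 < δ) (hΔ : 0 ≤ Δ) :
    numIter lam ρ ε (c * max 1 (Real.log (d * Δ / (lam * ε ^ 2 * δ)))) Δ ≤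
      400 * (c * (Real.log 2)⁻¹) ^ 4 * (Δ / (lam * ε ^ 2)) * Real.log d ^ 4 *
        (1 + Real.posLog (Δ / (lam * ε ^ 2 * δ))) ^ 4 := by
  have hone := le_max_left 1 (Real.log (d * Δ / (lam * ε ^ 2 * δ)))
  rw [numIter_eq_of_one_le hlam hρ hε (one_le_mul_of_one_le_of_one_le hc hone) hΔ, mul_div_assoc]
  calc 400 * (c * max 1 (Real.log (d * (Δ / (lam * ε ^ 2 * δ))))) ^ 4 * (Δ / (lam * ε ^ 2))
      ≤ 400 * (c * ((Real.log 2)⁻¹ * Real.log d *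
          (1 + Real.posLog (Δ / (lam * ε ^ 2 * δ))))) ^ 4 * (Δ / (lam * ε ^ 2)) := by
        gcongr
        exact max_one_log_mul_le hd (by positivity)
    _ = _ := by ring

end PerturbedProx

end

open PerturbedProx MeasureTheory ProbabilityTheory in
theorem theorem4p2 :
    ∃ c₀ : ℝ, 0 < c₀ ∧
      -- the iterates
      (∀ (d : ℕ) (f : Eu d → EReal) (ell lam ρ ε δ ι : ℝ) (x₀ : Eu d),
        0 < d → ClosedProper f → 0 < ell → WeaklyConvex f ell →
        0 < lam → lam < ell⁻¹ / 2 →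
        BddBelow (Set.range (moreau f lam)) →
        0 < ρ → 0 < ε → ε < 1 / (lam ^ 2 * ρ) → 0 < δ → δ < 1 →
        c₀ * max 1 (Real.log (d * gap (moreau f lam) x₀ / (lam * ε ^ 2 * δ))) ≤ ι →
        HessianLipschitzNearCritical (moreau f lam) ρ ε (locRadius ρ ε ι) →
        (Differentiable ℝ (moreau f lam) ∧
          ∀ x, prox f lam x = x - lam • gradient (moreau f lam) x) ∧
        ∀ (Ω : Type*) [MeasurableSpace Ω] (P : Measure Ω) [IsProbabilityMeasure P]
          (ξ : ℕ → Ω → Eu d),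
          (∀ t, Measurable (ξ t)) → iIndepFun ξ P →
          (∀ t, pdf.IsUniform (ξ t) (Metric.closedBall 0 (pertRadius ε ι)) P volume) →
          ENNReal.ofReal (1 - δ) ≤ P {ω | HalfGood f lam ρ ε ι x₀ (fun t => ξ t ω)
            ⌈numIter lam ρ ε ι (gap (moreau f lam) x₀)⌉₊}) ∧
      -- the order of the number of iterations
      (∀ c : ℝ, c₀ ≤ c → ∃ K : ℝ, ∀ (d : ℕ) (lam ρ ε δ Δ : ℝ),
        2 ≤ d → 0 < lam → 0 < ρ → 0 < ε → 0 < δ → 0 ≤ Δ →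
        numIter lam ρ ε (c * max 1 (Real.log (d * Δ / (lam * ε ^ 2 * δ)))) Δ ≤
          K * (Δ / (lam * ε ^ 2)) * Real.log d ^ 4 *
            (1 + Real.posLog (Δ / (lam * ε ^ 2 * δ))) ^ 4) := by
  refine ⟨10 ^ 30, by norm_num, ?_, fun c hc => ⟨400 * (c * (Real.log 2)⁻¹) ^ 4, ?_⟩⟩
  · intro d f ell lam ρ ε δ ι x₀ hd hf hell hweak hlam hlam' hbdd hρ hε hε' hδ₀ hδ₁ hι hH
    have hell' : 2 * ell ≤ lam⁻¹ := by
      rw [le_inv_comm₀ (by positivity) hlam, mul_inv_rev]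
      linarith
    have hF : IsSmoothWith (moreau f lam) lam := isSmoothWith_moreau hf hweak hlam hell'
    have hprox : prox f lam = gradStep (moreau f lam) lam := prox_eq_gradStep hf hweak hlam hell'
    have hone := le_max_left 1 (Real.log (d * gap (moreau f lam) x₀ / (lam * ε ^ 2 * δ)))
    have hadm : Admissible lam ρ ε ι := ⟨hlam, hρ, hε, hε', by linarith⟩
    refine ⟨⟨hF.differentiable, congrFun hprox⟩, fun Ω _ P _ ξ hξm hind hξ => ?_⟩
    exact (ofReal_one_sub_le_measure_half_le_ncard_settledAt hd hadm hF hH hbdd hδ₀ hδ₁.le hι rfl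
      hξm hind hξ).trans
        (measure_mono fun ω hω => halfGood_of_half_le_ncard_settledAt hd hprox hadm hH hω)
  · intro d lam ρ ε δ Δ hd hlam hρ hε hδ hΔ
    exact numIter_mul_max_one_log_le (by linarith) (by exact_mod_cast hd) hlam hρ hε hδ hΔ
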